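/- **Setting.** Let $d\in\{1,2\}$ and $T>0$. Let $\Omega\subset\mathbb R^d$ be a bounded polyhedral domain (open, connected, its closure a finite union of convex polytopes) with Lipschitz boundary, and let $Q_T=\Omega\times(0,T)$. For each $t\in[0,T]$ let $\Omega=\Omega_1(t)\cup\Omega_2(t)\cup\Gamma(t)$ with $\Omega_1(t),\Omega_2(t)$ open and disjoint and $\Gamma(t)=\partial\Omega_1(t)\cap\partial\Omega_2(t)$. Put $Q_i=\{(x,t): t\in(0,T),\ x\in\Omega_i(t)\}$ and $\Gamma^*=\bigcup_{t\in[0,T]}\Gamma(t)\times\{t\}$, and assume that $\Gamma^*=\partial Q_1\cap\partial Q_2$. Let $\mathbf v\in C([0,T],C^2(\Omega))^d$ be bounded with $\nabla\cdot\mathbf v(\cdot,t)=0$ in $\Omega$ for all $t\in[0,T]$. Assume that for $0<t<T$ the set $\Gamma^*$ is a $C^2$ hypersurface of $\mathbb R^{d+1}$ which moves with velocity $\mathbf v$, i.e. the direction $(\mathbf v,1)$ is tangent to it. Let $\kappa_1,\kappa_2>0$ be constants. **Spaces.** $\nabla$ denotes the spatial gradient. Let $Y=H^{1,0}_0(Q_T)$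 be the closure of $C^1_0(Q_T)$ in the norm $(\|u\|_{L^2(Q_T)}^2+\|\nabla u\|_{L^2(Q_T)}^2)^{1/2}$ and $Y'$ its dual. For $u\in Y$ let $\partial_tu$ be its distributional time derivative, $\partial_t u(\psi)=-\int_{Q_T}u\,\partial_t\psi$ for $\psi\in C_0^1(Q_T)$, and set $X_0=\{u\in Y:\ \partial_tu\in Y',\ u(\cdot,0)=0\}$, where the initial condition refers to the representative of $u$ in $C([0,T],L^2(\Omega))$. **Mesh.** Let $\mathcal T_h$ be a finite conforming decomposition of $\overline{Q_T}$ into closed $(d+1)$-simplices that is interface-fitted: every $K\in\mathcal T_h$ satisfies $K\subset\overline{Q_1}$, or $K\subset\overline{Q_2}$, or $K$ meets both $Q_1$ and $Q_2$ and exactly $d+1$ of its $d+2$ vertices lie on $\Gamma^*$. Let $\Gamma_h^*$ be the union of the $d$-dimensional faces of the mesh all of whose vertices lie on $\Gamma^*$. It separates $Q_T$ into two regions: $Q_{i,h}$ ($i=1,2$) is the part of $Q_T\setminus\Gamma_h^*$ covered by the elements $K$ that either lie in $\overline{Q_i}$, or meet both $Q_1$ and $Q_2$ and have their vertex off $\Gamma^*$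 in $\overline{Q_i}$. Let $\kappa_h=\kappa_i$ on $Q_{i,h}$, $i=1,2$. Let $V_h$ be the space of functions that are continuous on $\overline{Q_T}$, affine on each $K\in\mathcal T_h$, and zero on $\partial\Omega\times(0,T)$ and on $\Omega\times\{0\}$. **Theorem.** One has $V_h\subset X_0\subset Y$, and for every $f\in Y'$ there is a unique $u_h\in V_h$ such that $$a_h(u_h,\varphi_h)=\langle f,\varphi_h\rangle_{Y'\times Y}\qquad\text{for all }\varphi_h\in V_h,$$ where $a_h:X_0\times Y\to\mathbb R$ is the bilinear form $$a_h(u,\varphi)=\langle\partial_tu,\varphi\rangle_{Y'\times Y}+\int_0^T\!\!\int_\Omega\big((\mathbf v\cdot\nabla u)\,\varphi+\kappa_h\nabla u\cdot\nabla\varphi\big)\,dx\,dt .$$ -/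

import Mathlib

open Set MeasureTheory Topology
open scoped InnerProductSpace NNReal ENNReal

noncomputable section

namespace MovingInterface

/-- Space `ℝ^d`. -/
abbrev Space (d : ℕ) : Type := EuclideanSpace ℝ (Fin d)

/-- Space-time `ℝ^d × ℝ`; a point is `(x, t)`. -/
abbrev SpaceTime (d : ℕ) : Type := Space d × ℝ

/-! ### Geometry of the domain -/

/-- Near every boundary point, after choosing a "vertical" unit vector `e`, the set `Ω` is the
strict epigraph of a Lipschitz function of the component orthogonal to `e`. -/
def HasLipschitzBoundary {d : ℕ} (Ω : Set (Space d)) : Prop :=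
  ∀ p ∈ frontier Ω, ∃ e : Space d, ‖e‖ = 1 ∧ ∃ U : Set (Space d), IsOpen U ∧ p ∈ U ∧
    ∃ (L : ℝ≥0) (g : Space d → ℝ), LipschitzWith L g ∧
      ∀ x ∈ U, (x ∈ Ω ↔ g (x - ⟪e, x⟫_ℝ • e) < ⟪e, x⟫_ℝ)

/-- The closure of `Ω` is a finite union of convex polytopes. -/
def IsPolyhedral {d : ℕ} (Ω : Set (Space d)) : Prop :=
  ∃ S : Finset (Finset (Space d)), closure Ω = ⋃ s ∈ S, convexHull ℝ (s : Set (Space d))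

/-- The data of the moving interface problem: the domain `Ω`, the final time `T`, the two moving
subdomains `Ω_1(t) = sub 0 t` and `Ω_2(t) = sub 1 t`, the velocity `v x t`, and the two
diffusion constants `κ_1 = κ 0`, `κ_2 = κ 1`. -/
structure InterfaceData (d : ℕ) where
  Ω : Set (Space d)
  T : ℝ
  sub : Fin 2 → ℝ → Set (Space d)
  vel : Space d → ℝ → Space d
  κ : Fin 2 → ℝ

namespace InterfaceData

variable {d : ℕ} (P : InterfaceData d)

/-- The space-time cylinder `Q_T = Ω × (0, T)`. -/
def QT : Set (SpaceTime d) := P.Ω ×ˢ Ioo 0 P.T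

/-- The space-time subdomains `Q_1 = Q 0`, `Q_2 = Q 1`. -/
def Q (i : Fin 2) : Set (SpaceTime d) := {p | p.2 ∈ Ioo 0 P.T ∧ p.1 ∈ P.sub i p.2}

/-- The interface `Γ(t) = ∂Ω_1(t) ∩ ∂Ω_2(t)`. -/
def Γ (t : ℝ) : Set (Space d) := frontier (P.sub 0 t) ∩ frontier (P.sub 1 t)

/-- The space-time interface, including its end slices at `t = 0` and `t = T`. -/
def Γst : Set (SpaceTime d) := {p | p.2 ∈ Icc 0 P.T ∧ p.1 ∈ P.Γ p.2}

/-- The velocity belongs to `C([0,T], C²(Ω))`, is bounded, and is divergence free in space.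
(Joint continuity of the spatial derivatives up to order two on `Ω × [0,T]` says that
`t ↦ v(·,t)` is continuous for locally uniform convergence of these derivatives.) -/
structure IsVelocity : Prop where
  contDiffOn : ∀ t ∈ Icc 0 P.T, ContDiffOn ℝ 2 (fun x => P.vel x t) P.Ω
  continuousOn : ∀ m : ℕ, m ≤ 2 → ContinuousOn
    (fun p : SpaceTime d => iteratedFDeriv ℝ m (fun x => P.vel x p.2) p.1) (P.Ω ×ˢ Icc 0 P.T)
  bounded : ∃ C : ℝ, ∀ x ∈ P.Ω, ∀ t ∈ Icc 0 P.T, ‖P.vel x t‖ ≤ C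
  div_eq_zero : ∀ x ∈ P.Ω, ∀ t ∈ Icc 0 P.T,
    ∑ i : Fin d, (fderiv ℝ (fun y => P.vel y t) x (EuclideanSpace.single i 1)) i = 0

/-- The standing assumptions on the data. -/
structure IsAdmissible : Prop where
  isOpen : IsOpen P.Ω
  isConnected : IsConnected P.Ω
  isBounded : Bornology.IsBounded P.Ω
  lipschitz : HasLipschitzBoundary P.Ω
  polyhedral : IsPolyhedral P.Ω
  T_pos : 0 < P.T
  κ_pos : ∀ i, 0 < P.κ i
  velocity : P.IsVelocity
  sub_isOpen : ∀ i, ∀ t ∈ Icc 0 P.T, IsOpen (P.sub i t)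
  sub_disjoint : ∀ t ∈ Icc 0 P.T, Disjoint (P.sub 0 t) (P.sub 1 t)
  decomposition : ∀ t ∈ Icc 0 P.T, P.Ω = P.sub 0 t ∪ P.sub 1 t ∪ P.Γ t
  /-- The space-time interface is the common boundary of the space-time subdomains. -/
  interface : frontier (P.Q 0) ∩ frontier (P.Q 1) = P.Γst
  /-- For `0 < t < T` the space-time interface is a `C²` hypersurface, locally the zero set of a
  `C²` function `g` with nonzero derivative, and it moves with the velocity `v`: the space-time
  direction `(v, 1)` is tangent to it. -/
  hypersurface : ∀ p ∈ P.Γst, p.2 ∈ Ioo 0 P.T →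
    ∃ (U : Set (SpaceTime d)) (g : SpaceTime d → ℝ), IsOpen U ∧ p ∈ U ∧ ContDiffOn ℝ 2 g U ∧
      (∀ q ∈ U, q ∈ P.Γst ↔ g q = 0) ∧
      ∀ q ∈ U, g q = 0 → fderiv ℝ g q ≠ 0 ∧ fderiv ℝ g q (P.vel q.1 q.2, 1) = 0

end InterfaceData

/-! ### The space `Y = H^{1,0}_0(Q)` and its dual -/

/-- Spatial gradient `∇φ` of a function on space-time. -/
def gradX {d : ℕ} (φ : SpaceTime d → ℝ) (p : SpaceTime d) : Space d :=
  gradient (fun x => φ (x, p.2)) p.1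

/-- Time derivative `∂_t φ` of a function on space-time. -/
def derivT {d : ℕ} (φ : SpaceTime d → ℝ) (p : SpaceTime d) : ℝ :=
  deriv (fun s => φ (p.1, s)) p.2

/-- `C^1_0(Q)`: continuously differentiable functions with compact support in `Q`. -/
structure TestFun {d : ℕ} (Q : Set (SpaceTime d)) where
  toFun : SpaceTime d → ℝ
  contDiff : ContDiff ℝ 1 toFun
  hasCompactSupport : HasCompactSupport toFun
  tsupport_subset : tsupport toFun ⊆ Q

/-- `L²(Q) × L²(Q; ℝ^d)` with the norm `(‖u‖² + ‖w‖²)^{1/2}`; on pairs `(u, ∇u)` this is the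
norm of `H^{1,0}(Q)`. -/
abbrev GraphL2 {d : ℕ} (Q : Set (SpaceTime d)) : Type :=
  WithLp 2 (Lp ℝ 2 (volume.restrict Q) × Lp (Space d) 2 (volume.restrict Q))

section TestFun

variable {d : ℕ} {Q : Set (SpaceTime d)}

theorem TestFun.gradX_eq (ψ : TestFun Q) (p : SpaceTime d) :
    gradX ψ.toFun p = (InnerProductSpace.toDual ℝ (Space d)).symm
      ((fderiv ℝ ψ.toFun p).comp (ContinuousLinearMap.inl ℝ (Space d) ℝ)) := by
  have h1 : HasFDerivAt ψ.toFun (fderiv ℝ ψ.toFun p) (p.1, p.2) :=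
    (ψ.contDiff.differentiable (by norm_num) p).hasFDerivAt
  have h2 := h1.comp p.1 (hasFDerivAt_prodMk_left (𝕜 := ℝ) p.1 p.2)
  unfold gradX gradient
  congr 1
  exact h2.fderiv

theorem TestFun.continuous_gradX (ψ : TestFun Q) : Continuous (gradX ψ.toFun) := by
  have h : gradX ψ.toFun = fun p => (InnerProductSpace.toDual ℝ (Space d)).symm
      ((fderiv ℝ ψ.toFun p).comp (ContinuousLinearMap.inl ℝ (Space d) ℝ)) := by
    funext p; exact ψ.gradX_eq p
  rw [h]
  have hc : Continuous (fderiv ℝ ψ.toFun) := ψ.contDiff.continuous_fderiv (by norm_num)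
  exact (LinearIsometryEquiv.continuous _).comp (hc.clm_comp continuous_const)

theorem TestFun.hasCompactSupport_gradX (ψ : TestFun Q) : HasCompactSupport (gradX ψ.toFun) := by
  refine (ψ.hasCompactSupport.fderiv ℝ).mono fun p hp => ?_
  rw [Function.mem_support] at hp ⊢
  intro h
  apply hp
  rw [ψ.gradX_eq p, h]
  simp

/-- The pair `(ψ, ∇ψ)` in `L²(Q) × L²(Q; ℝ^d)`. -/
def TestFun.toGraph (ψ : TestFun Q) : GraphL2 Q :=
  WithLp.toLp 2
    ((ψ.contDiff.continuous.memLp_of_hasCompactSupport (p := 2) (μ := volume.restrict Q)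
        ψ.hasCompactSupport).toLp,
      (ψ.continuous_gradX.memLp_of_hasCompactSupport (p := 2) (μ := volume.restrict Q)
        ψ.hasCompactSupport_gradX).toLp)

end TestFun

/-- `H^{1,0}_0(Q)`, the closure of `C^1_0(Q)` in the norm of `H^{1,0}(Q)`. An element is realised
as the pair `(u, ∇u)` of an `L²` function and its weak spatial gradient. (The pairs `(ψ, ∇ψ)`
already form a linear space, so that the span adds nothing.) -/
def H10 {d : ℕ} (Q : Set (SpaceTime d)) : Submodule ℝ (GraphL2 Q) :=
  (Submodule.span ℝ (range (TestFun.toGraph (Q := Q)))).topologicalClosure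

section H10

variable {d : ℕ} {Q : Set (SpaceTime d)}

/-- The function underlying an element of `H^{1,0}_0(Q)`. -/
def val (u : H10 Q) : SpaceTime d → ℝ := fun p => (u : GraphL2 Q).fst p

/-- The spatial gradient of an element of `H^{1,0}_0(Q)`. -/
def grad (u : H10 Q) : SpaceTime d → Space d := fun p => (u : GraphL2 Q).snd p

/-- A test function as an element of `H^{1,0}_0(Q)`. -/
def TestFun.toH10 (ψ : TestFun Q) : H10 Q :=
  ⟨ψ.toGraph, Submodule.le_topologicalClosure _ (Submodule.subset_span ⟨ψ, rfl⟩)⟩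

/-- The functional `g ∈ Y'` is the distributional time derivative of `u`:
`⟨g, ψ⟩ = - ∫_Q u ∂_t ψ` for all `ψ ∈ C^1_0(Q)`. By density there is at most one such `g`. -/
def HasTimeDeriv (u : H10 Q) (g : StrongDual ℝ (H10 Q)) : Prop :=
  ∀ ψ : TestFun Q, g ψ.toH10 = - ∫ p in Q, val u p * derivT ψ.toFun p

end H10

namespace InterfaceData

variable {d : ℕ} (P : InterfaceData d)

/-- The space `Y = H^{1,0}_0(Q_T)`; its dual `Y'` is `StrongDual ℝ P.Y`. -/
abbrev Y : Type := H10 P.QT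

/-- `X = {u ∈ Y : ∂_t u ∈ Y'}`. -/
def X : Set P.Y := {u | ∃ g : StrongDual ℝ P.Y, HasTimeDeriv u g}

/-- `u(·, 0) = 0`, in the sense of the representative of `u` that is continuous on `[0,T]` with
values in `L²(Ω)`. -/
def VanishesAtZero (u : P.Y) : Prop :=
  ∃ w : ℝ → Lp ℝ 2 (volume.restrict P.Ω), ContinuousOn w (Icc 0 P.T) ∧ w 0 = 0 ∧
    ∀ᵐ t ∂(volume.restrict (Ioo 0 P.T)), ∀ᵐ x ∂(volume.restrict P.Ω), w t x = val u (x, t)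

/-- `X_0 = {u ∈ X : u(·, 0) = 0}`. -/
def X₀ : Set P.Y := {u | u ∈ P.X ∧ P.VanishesAtZero u}

/-- The time derivative `∂_t u ∈ Y'` of `u ∈ X_0`. -/
def timeDeriv (u : P.X₀) : StrongDual ℝ P.Y := Classical.choose u.2.1

theorem hasTimeDeriv_timeDeriv (u : P.X₀) : HasTimeDeriv (u : P.Y) (P.timeDeriv u) :=
  Classical.choose_spec u.2.1

/-! ### Interface-fitted meshes -/

variable (𝒯 : Geometry.SimplicialComplex ℝ (SpaceTime d))

/-- The elements (triangles for `d = 1`, tetrahedra for `d = 2`), given by their `d + 2`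
vertices; the element itself is the convex hull of the vertices. -/
def elements {d : ℕ} (𝒯 : Geometry.SimplicialComplex ℝ (SpaceTime d)) :
    Set (Finset (SpaceTime d)) := {s | s ∈ 𝒯.faces ∧ s.card = d + 2}

/-- The element with vertex set `s` is cut: it meets both `Q_1` and `Q_2`. -/
def IsCut (s : Finset (SpaceTime d)) : Prop :=
  ∀ i, (convexHull ℝ (s : Set (SpaceTime d)) ∩ P.Q i).Nonempty

/-- `𝒯` is a conforming simplicial decomposition of (the closure of) `Q_T` into finitely many
`(d+1)`-simplices that is fitted to the interface: every element lies in the closure of `Q_1`,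
or lies in the closure of `Q_2`, or meets both and has `d + 1` of its `d + 2` vertices on the
interface. -/
structure IsFittedMesh : Prop where
  finite : 𝒯.faces.Finite
  space_eq : 𝒯.space = closure P.QT
  pure : ∀ s ∈ 𝒯.faces, ∃ K ∈ elements 𝒯, s ⊆ K
  fitted : ∀ K ∈ elements 𝒯,
    convexHull ℝ (K : Set (SpaceTime d)) ⊆ closure (P.Q 0) ∨
    convexHull ℝ (K : Set (SpaceTime d)) ⊆ closure (P.Q 1) ∨
    (P.IsCut K ∧ {p | p ∈ K ∧ p ∈ P.Γst}.ncard = d + 1)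

/-- The discrete interface `Γ_h^*`: the union of the `d`-dimensional faces (edges for `d = 1`,
triangles for `d = 2`) all of whose vertices lie on the interface. -/
def Γh : Set (SpaceTime d) :=
  {p | ∃ s ∈ 𝒯.faces, s.card = d + 1 ∧ (s : Set (SpaceTime d)) ⊆ P.Γst ∧
    p ∈ convexHull ℝ (s : Set (SpaceTime d))}

/-- The element with vertex set `K` belongs to the discrete region number `i`: either it lies in
the closure of `Q_i`, or it is cut and its vertex off the interface lies in the closure of
`Q_i`. -/
def OnSide (i : Fin 2) (K : Finset (SpaceTime d)) : Prop :=
  convexHull ℝ (K : Set (SpaceTime d)) ⊆ closure (P.Q i) ∨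
    (P.IsCut K ∧ ∃ p ∈ K, p ∉ P.Γst ∧ p ∈ closure (P.Q i))

/-- The two regions `Q_{1,h} = Qh 0`, `Q_{2,h} = Qh 1` into which `Γ_h^*` separates `Q_T`. -/
def Qh (i : Fin 2) : Set (SpaceTime d) :=
  {p | p ∈ P.QT ∧ p ∉ P.Γh 𝒯 ∧ ∃ K ∈ elements 𝒯, P.OnSide i K ∧
    p ∈ convexHull ℝ (K : Set (SpaceTime d))}

open Classical in
/-- `κ_h`: equal to `κ_1` on `Q_{1,h}` and to `κ_2` on `Q_{2,h}`. The value `0` is only taken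
outside `Q_T` and on the null set `Γ_h^*`. -/
def κh (p : SpaceTime d) : ℝ :=
  if p ∈ P.Qh 𝒯 0 then P.κ 0 else if p ∈ P.Qh 𝒯 1 then P.κ 1 else 0

/-- `φ` is a finite element function: continuous on the closure of `Q_T`, affine on each element,
and zero on `∂Ω × (0,T)` and on `Ω × {0}`. -/
structure IsFEFun (φ : SpaceTime d → ℝ) : Prop where
  continuousOn : ContinuousOn φ (closure P.QT)
  affine : ∀ K ∈ elements 𝒯, ∃ A : SpaceTime d →ᵃ[ℝ] ℝ,
    EqOn φ A (convexHull ℝ (K : Set (SpaceTime d)))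
  zero_lateral : ∀ x ∈ frontier P.Ω, ∀ t ∈ Ioo 0 P.T, φ (x, t) = 0
  zero_initial : ∀ x ∈ P.Ω, φ (x, 0) = 0

/-- The finite element space `V_h`, as a subset of `Y`. -/
def Vh : Set P.Y := {u | ∃ φ, P.IsFEFun 𝒯 φ ∧ val u =ᵐ[volume.restrict P.QT] φ}

/-- The bilinear form
`a_h(u, φ) = ⟨∂_t u, φ⟩ + ∫_{Q_T} (v · ∇u) φ + κ_h ∇u · ∇φ` on `X_0 × Y`. -/
def ah (u : P.X₀) (φ : P.Y) : ℝ :=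
  P.timeDeriv u φ + ∫ p in P.QT,
    (⟪P.vel p.1 p.2, grad (u : P.Y) p⟫_ℝ * val φ p
      + P.κh 𝒯 p * ⟪grad (u : P.Y) p, grad φ p⟫_ℝ)

end InterfaceData

end MovingInterface

end

open Set MeasureTheory Topology
open scoped InnerProductSpace NNReal ENNReal

noncomputable section

namespace MovingInterface

/-! ### Lipschitz functions -/

/-! The discrete problem is a square linear system: a finite element function is determined on the
closed cylinder by its vertex values, so `V_h` is finite-dimensional (`exists_submodule_eq_Vh`). It
therefore suffices that `a_h(u, u) = 0` with `u ∈ V_h` forces `u = 0` (`existsUnique_of_definite`);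
no inf-sup constant is involved.

On the diagonal the three terms of `a_h` behave as follows. The time term is nonnegative, formally
half the squared `L²` norm at time `T`, because `u` starts from zero
(`integral_lineDeriv_mul_self_nonneg`). The convection term vanishes because the velocity is
divergence free and `u` is a limit of compactly supported functions (`integral_inner_grad_mul_val`).
The diffusion term is nonnegative and vanishes only if `∇u = 0`, because `κ_h > 0` almost everywhere
(`ae_κh_pos`). The same integration by parts, with the field `x` of divergence `d` in place of the
velocity, then gives `u = 0` (`eq_zero_of_grad_eq_zero`).

The analytic work is `V_h ⊂ X_0`. A finite element function extends to a globally Lipschitz function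
that vanishes outside `Ω` and for `t ≤ 0` (`IsFEFun.exists_lipschitz`). Mollifying it, cutting off
small values and cutting off in time gives test functions converging in the norm of `H^{1,0}`
(`exists_H10_of_lipschitz`); the time cutoff is harmless because this norm contains no time
derivative. The pointwise time derivative is bounded and represents `∂_t u` in `Y'`
(`exists_hasTimeDeriv_of_lipschitz`). -/

/-- A function on a convex set that is `L`-Lipschitz on each of finitely many closed sets covering
it is `L`-Lipschitz. -/
theorem lipschitzOnWith_of_finite_closed_cover {E ι : Type*} [NormedAddCommGroup E]
    [NormedSpace ℝ E] [Finite ι] {S : Set E} (hS : Convex ℝ S) {F : ι → Set E}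
    (hF : ∀ i, IsClosed (F i)) (hcov : S ⊆ ⋃ i, F i) {f : E → ℝ} {L : ℝ≥0}
    (hf : ∀ i, LipschitzOnWith L f (F i ∩ S)) : LipschitzOnWith L f S := by
  refine LipschitzOnWith.of_le_add_mul L fun z hz y hy => ?_
  set c : ℝ → E := fun s => AffineMap.lineMap y z s with hc
  have hcS : ∀ s ∈ Icc (0 : ℝ) 1, c s ∈ S := fun s hs =>
    hS.segment_subset hy hz (by rw [segment_eq_image_lineMap]; exact ⟨s, hs, rfl⟩)
  have hcc : Continuous c := AffineMap.lineMap_continuous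
  have hcd : ∀ s t, dist (c s) (c t) = |s - t| * dist y z := fun s t => by
    rw [hc]; simp only [dist_lineMap_lineMap, Real.dist_eq]
  set G : ι → Set ℝ := fun i => c ⁻¹' (F i) ∩ Icc 0 1 with hG
  have hGc : ∀ i, IsClosed (G i) := fun i => ((hF i).preimage hcc).inter isClosed_Icc
  have hGcov : Icc (0 : ℝ) 1 ⊆ ⋃ i, G i := fun s hs => by
    obtain ⟨i, hi⟩ := mem_iUnion.1 (hcov (hcS s hs))
    exact mem_iUnion.2 ⟨i, hi, hs⟩
  have hlip : ∀ i, ∀ s ∈ G i, ∀ t ∈ G i, f (c s) - f (c t) ≤ L * dist z y * |s - t| := by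
    intro i s hs t ht
    have := (hf i).dist_le_mul (c s) ⟨hs.1, hcS s hs.2⟩ (c t) ⟨ht.1, hcS t ht.2⟩
    rw [hcd, Real.dist_eq, dist_comm y z] at this
    calc _ ≤ |f (c s) - f (c t)| := le_abs_self _
      _ ≤ _ := this
      _ = _ := by ring
  have hcont : ContinuousOn (fun s => f (c s)) (Icc 0 1) := by
    refine ContinuousOn.mono ?_ hGcov
    refine LocallyFinite.continuousOn_iUnion (locallyFinite_of_finite _) hGc fun i => ?_
    exact ((hf i).continuousOn.comp hcc.continuousOn fun s hs => ⟨hs.1, hcS s hs.2⟩)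
  -- Mean value inequality along the segment from `y` to `z`: near each point it is enough to find
  -- right difference quotients, arbitrarily close to the point, below any slope exceeding `L * dist
  -- z y`.
  have key := image_le_of_liminf_slope_right_le_deriv_boundary (f := fun s => f (c s))
    (a := 0) (b := 1) hcont (B := fun s => f y + L * dist z y * s)
    (B' := fun _ => L * dist z y) (by simp [hc]) (by fun_prop) (fun x _ => by
      simpa using (((hasDerivAt_id x).const_mul (L * dist z y : ℝ)).const_add
        (f y)).hasDerivWithinAt) ?_ (right_mem_Icc.2 zero_le_one)
  · simpa [hc] using key
  · intro x hx r hr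
    -- Finitely many closed sets cover the points just to the right of `x`, so one of them is hit
    -- arbitrarily close to `x` and, being closed, contains `x` as well.
    obtain ⟨i, hi⟩ : ∃ i, ∃ᶠ s in 𝓝[>] x, s ∈ G i := by
      by_contra! h
      have h1 : ∀ᶠ s in 𝓝[>] x, s ∈ Icc (0 : ℝ) 1 := by
        filter_upwards [Ioo_mem_nhdsGT hx.2] with s hs
        exact ⟨hx.1.trans hs.1.le, hs.2.le⟩
      obtain ⟨s, hs, hs'⟩ := ((Filter.eventually_all.2 h).and h1).exists
      obtain ⟨i, hi⟩ := mem_iUnion.1 (hGcov hs')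
      exact hs i hi
    have hxi : x ∈ G i := (hGc i).mem_of_frequently_of_tendsto hi
      (Filter.tendsto_id.mono_left nhdsWithin_le_nhds)
    refine (hi.and_eventually self_mem_nhdsWithin).mono fun s hs => ?_
    have hsx : 0 < s - x := sub_pos.2 hs.2
    rw [slope_def_field, div_lt_iff₀ hsx]
    calc _ ≤ L * dist z y * |s - x| := hlip i s hs.1 x hxi
      _ = L * dist z y * (s - x) := by rw [abs_of_pos hsx]
      _ < r * (s - x) := by gcongr

/-! ### Mollification of Lipschitz functions. -/

section Mollify

variable {E : Type*} [NormedAddCommGroup E] [NormedSpace ℝ E] [FiniteDimensional ℝ E]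
  [MeasurableSpace E] [BorelSpace E] (μ : Measure E) [μ.IsAddHaarMeasure]

theorem locallyIntegrable_fderiv_of_lipschitz {f : E → ℝ} {L : ℝ≥0} (hf : LipschitzWith L f) :
    LocallyIntegrable (fderiv ℝ f) μ := by
  refine (locallyIntegrable_const (μ := μ) (L : ℝ)).mono
    (measurable_fderiv ℝ f).aestronglyMeasurable (Filter.Eventually.of_forall fun x => ?_)
  simpa using norm_fderiv_le_of_lipschitz ℝ hf

/-- Differentiation under the integral sign: the integrand is Lipschitz in `z` with integrable
constant, and Rademacher's theorem makes it differentiable for almost every `y`. The derivative thus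
falls on `f`, which later yields both the bound `L` and the convergence of the derivatives. -/
theorem hasFDerivAt_bump_convolution {f : E → ℝ} {L : ℝ≥0} (hf : LipschitzWith L f)
    (φ : ContDiffBump (0 : E)) (x : E) :
    HasFDerivAt (convolution (φ.normed μ) f (ContinuousLinearMap.lsmul ℝ ℝ) μ)
      (convolution (φ.normed μ) (fderiv ℝ f) (ContinuousLinearMap.lsmul ℝ ℝ) μ x) x := by
  have hφi : Integrable (φ.normed μ) μ := φ.integrable_normed
  refine (hasFDerivAt_integral_of_dominated_loc_of_lip (μ := μ) (𝕜 := ℝ) (s := univ)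
    (F := fun z y => φ.normed μ y • f (z - y))
    (F' := fun y => φ.normed μ y • fderiv ℝ f (x - y))
    (bound := fun y => L * φ.normed μ y) Filter.univ_mem ?_ ?_ ?_ ?_ ?_ ?_).2
  · refine Filter.Eventually.of_forall fun z => Continuous.aestronglyMeasurable ?_
    exact φ.continuous_normed.smul (hf.continuous.comp (by fun_prop))
  · refine Continuous.integrable_of_hasCompactSupport ?_ ?_
    · exact φ.continuous_normed.smul (hf.continuous.comp (by fun_prop))
    · exact φ.hasCompactSupport_normed.smul_right
  · exact φ.continuous_normed.aestronglyMeasurable.smul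
      ((measurable_fderiv ℝ f).comp (measurable_const.sub measurable_id)).aestronglyMeasurable
  · refine Filter.Eventually.of_forall fun y => LipschitzOnWith.of_dist_le_mul fun z _ w _ => ?_
    have := hf.dist_le_mul (z - y) (w - y)
    have h0 := φ.nonneg_normed (μ := μ) y
    rw [dist_sub_right] at this
    simp only [smul_eq_mul, Real.dist_eq, ← mul_sub, abs_mul, Real.coe_nnabs,
      NNReal.abs_eq, abs_of_nonneg h0]
    rw [Real.dist_eq] at this
    nlinarith
  · exact hφi.const_mul _
  · have h := (Measure.measurePreserving_sub_left μ x).quasiMeasurePreserving.ae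
      (hf.ae_differentiableAt (μ := μ))
    filter_upwards [h] with y hy
    have h2 := hy.hasFDerivAt.comp x ((hasFDerivAt_id x).sub_const y)
    exact h2.const_smul (φ.normed μ y)

/-- Mollification of a Lipschitz function: uniform convergence, the same Lipschitz bound, and
convergence of the derivatives almost everywhere. -/
theorem exists_smooth_approx_of_lipschitz {f : E → ℝ} {L : ℝ≥0} (hf : LipschitzWith L f) :
    ∃ g : ℕ → E → ℝ, (∀ n, ContDiff ℝ 1 (g n)) ∧ (∀ n x, |g n x - f x| ≤ L * (1 / ((n : ℝ) + 1))) ∧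
      (∀ n x, ‖fderiv ℝ (g n) x‖ ≤ L) ∧
      ∀ᵐ x ∂μ, Filter.Tendsto (fun n => fderiv ℝ (g n) x) Filter.atTop (𝓝 (fderiv ℝ f x)) := by
  -- The ratio of outer to inner radius is fixed at 2, as the almost everywhere convergence of the
  -- convolutions requires a bounded ratio.
  let φ : ℕ → ContDiffBump (0 : E) := fun n =>
    ⟨1 / 2 * (1 / ((n : ℝ) + 1)), 1 / ((n : ℝ) + 1), by positivity, by
      have : 0 < 1 / ((n : ℝ) + 1) := by positivity
      linarith⟩
  refine ⟨fun n => convolution ((φ n).normed μ) f (ContinuousLinearMap.lsmul ℝ ℝ) μ, fun n => ?_,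
    fun n x => ?_, fun n x => ?_, ?_⟩
  · exact (φ n).hasCompactSupport_normed.contDiff_convolution_left _ (φ n).contDiff_normed
      hf.continuous.locallyIntegrable
  · have h := (φ n).dist_normed_convolution_le (μ := μ) (g := f) (x₀ := x)
      (ε := L * (1 / ((n : ℝ) + 1))) hf.continuous.aestronglyMeasurable (fun y hy => by
        refine (hf.dist_le_mul y x).trans ?_
        have : dist y x ≤ 1 / ((n : ℝ) + 1) := le_of_lt hy
        gcongr)
    rwa [Real.dist_eq] at h
  · rw [(hasFDerivAt_bump_convolution μ hf (φ n) x).fderiv]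
    have h : ‖∫ y, (φ n).normed μ y • fderiv ℝ f (x - y) ∂μ‖ ≤ ∫ y, L * (φ n).normed μ y ∂μ := by
      refine norm_integral_le_of_norm_le ((φ n).integrable_normed.const_mul _)
        (Filter.Eventually.of_forall fun y => ?_)
      have h0 := (φ n).nonneg_normed (μ := μ) y
      rw [norm_smul, Real.norm_of_nonneg h0, mul_comm]
      have := norm_fderiv_le_of_lipschitz ℝ hf (x₀ := x - y)
      gcongr
    rw [integral_const_mul, (φ n).integral_normed, mul_one] at h
    exact h
  · have h := ContDiffBump.ae_convolution_tendsto_right_of_locallyIntegrable (μ := μ) (φ := φ)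
      (l := Filter.atTop) (K := 2) (g := fderiv ℝ f) tendsto_one_div_add_atTop_nhds_zero_nat
      (Filter.Eventually.of_forall fun n => by simp [φ])
      (locallyIntegrable_fderiv_of_lipschitz μ hf)
    filter_upwards [h] with x hx
    refine hx.congr fun n => ?_
    exact (hasFDerivAt_bump_convolution μ hf (φ n) x).fderiv.symm

end Mollify

/-! ### Cutoff functions -/

/-- A family of `C¹` functions that vanish near `0`, agree with the identity away from `0`, and
have uniformly bounded derivatives. -/
theorem exists_shrink : ∃ M : ℝ, ∀ ε > 0, ∃ η : ℝ → ℝ, ContDiff ℝ 1 η ∧ (∀ s, |s| ≤ ε → η s = 0) ∧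
    (∀ s, 2 * ε ≤ |s| → η s = s) ∧ (∀ s, |η s| ≤ |s|) ∧ ∀ s, |deriv η s| ≤ M := by
  -- Vanishes for `|s| ≤ 1` and is the identity once `s ^ 2 ≥ 2`.
  let η : ℝ → ℝ := fun s => s * Real.smoothTransition (s ^ 2 - 1)
  have hη : ContDiff ℝ 1 η :=
    contDiff_id.mul (Real.smoothTransition.contDiff.comp ((contDiff_id.pow 2).sub contDiff_const))
  have h0 : ∀ s, |s| ≤ 1 → η s = 0 := fun s hs => by
    have : s ^ 2 - 1 ≤ 0 := by
      have := (sq_le_one_iff_abs_le_one s).2 hs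
      linarith
    simp [η, Real.smoothTransition.zero_of_nonpos this]
  have h1 : ∀ s, 2 ≤ s ^ 2 → η s = s := fun s hs => by
    have : 1 ≤ s ^ 2 - 1 := by linarith
    simp [η, Real.smoothTransition.one_of_one_le this]
  obtain ⟨C, hC⟩ := (isCompact_Icc (a := (-2 : ℝ)) (b := 2)).exists_bound_of_continuousOn
    (hη.continuous_deriv le_rfl).continuousOn
  have hM : ∀ s, |deriv η s| ≤ max C 1 := fun s => by
    by_cases hs : s ∈ Icc (-2 : ℝ) 2
    · exact (hC s hs).trans (le_max_left _ _)
    · have hs2 : 2 < s ^ 2 := by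
        by_contra! h
        exact hs ⟨by nlinarith, by nlinarith⟩
      have : η =ᶠ[𝓝 s] id := by
        have ho : IsOpen {s : ℝ | 2 < s ^ 2} := isOpen_lt continuous_const (by fun_prop)
        filter_upwards [ho.mem_nhds hs2] with r hr
        exact h1 r (le_of_lt hr)
      rw [this.deriv_eq, deriv_id]
      simp
  -- This scaling leaves the derivative bound independent of `ε`.
  refine ⟨max C 1, fun ε hε => ⟨fun s => ε * η (s / ε), ?_, fun s hs => ?_, fun s hs => ?_,
    fun s => ?_, fun s => ?_⟩⟩
  · exact contDiff_const.mul (hη.comp (contDiff_id.div_const ε))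
  · have : |s / ε| ≤ 1 := by rw [abs_div, abs_of_pos hε, div_le_one hε]; exact hs
    simp [h0 _ this]
  · have : 2 ≤ |s / ε| := by rw [abs_div, abs_of_pos hε, le_div_iff₀ hε]; exact hs
    simp only [h1 (s / ε) (by rw [← sq_abs]; nlinarith)]
    field_simp
  · have h : |η (s / ε)| ≤ |s / ε| := by
      simp only [η, abs_mul, abs_of_nonneg (Real.smoothTransition.nonneg _)]
      exact mul_le_of_le_one_right (abs_nonneg _) (Real.smoothTransition.le_one _)
    rw [abs_mul, abs_of_pos hε]
    calc ε * |η (s / ε)| ≤ ε * |s / ε| := by gcongr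
      _ = |s| := by rw [abs_div, abs_of_pos hε]; field_simp
  · have hd : HasDerivAt (fun s => ε * η (s / ε)) (ε * (deriv η (s / ε) * (1 / ε))) s :=
      (HasDerivAt.comp (h₂ := η) s (hη.differentiable one_ne_zero (s / ε)).hasDerivAt
        ((hasDerivAt_id s).div_const ε)).const_mul ε
    rw [hd.deriv]
    have : ε * (deriv η (s / ε) * (1 / ε)) = deriv η (s / ε) := by field_simp
    rw [this]
    exact hM _

/-- Smooth cutoff functions on an interval `(0, T)`. -/
theorem exists_time_cutoff (T : ℝ) {δ : ℝ} (hδ : 0 < δ) : ∃ χ : ℝ → ℝ, ContDiff ℝ 1 χ ∧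
    (∀ t, 0 ≤ χ t ∧ χ t ≤ 1) ∧ (∀ t, χ t ≠ 0 → t ∈ Icc δ (T - δ)) ∧
    ∀ t ∈ Icc (2 * δ) (T - 2 * δ), χ t = 1 := by
  refine ⟨fun t => Real.smoothTransition (t / δ - 1) * Real.smoothTransition ((T - t) / δ - 1),
    ?_, fun t => ⟨?_, ?_⟩, fun t ht => ?_, fun t ht => ?_⟩
  · exact (Real.smoothTransition.contDiff.comp ((contDiff_id.div_const δ).sub contDiff_const)).mul
      (Real.smoothTransition.contDiff.comp
        (((contDiff_const.sub contDiff_id).div_const δ).sub contDiff_const))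
  · exact mul_nonneg (Real.smoothTransition.nonneg _) (Real.smoothTransition.nonneg _)
  · exact mul_le_one₀ (Real.smoothTransition.le_one _) (Real.smoothTransition.nonneg _)
      (Real.smoothTransition.le_one _)
  · have h1 : 0 < t / δ - 1 := by
      by_contra! h
      exact ht (by simp [Real.smoothTransition.zero_of_nonpos h])
    have h2 : 0 < (T - t) / δ - 1 := by
      by_contra! h
      exact ht (by simp [Real.smoothTransition.zero_of_nonpos h])
    rw [sub_pos, lt_div_iff₀ hδ] at h1 h2
    constructor <;> linarith
  · have h1 : 1 ≤ t / δ - 1 := by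
      rw [le_sub_iff_add_le, le_div_iff₀ hδ]; linarith [ht.1]
    have h2 : 1 ≤ (T - t) / δ - 1 := by
      rw [le_sub_iff_add_le, le_div_iff₀ hδ]; linarith [ht.2]
    simp [Real.smoothTransition.one_of_one_le h1, Real.smoothTransition.one_of_one_le h2]

/-- Bounded almost everywhere convergence implies convergence in `L²` on a finite measure space. -/
theorem tendsto_toLp_of_bounded {α F : Type*} [MeasurableSpace α] {μ : Measure α}
    [IsFiniteMeasure μ] [NormedAddCommGroup F] {f : ℕ → α → F} {g : α → F} {C : ℝ}
    (hf : ∀ n, MemLp (f n) 2 μ) (hg : MemLp g 2 μ) (hfC : ∀ n, ∀ᵐ x ∂μ, ‖f n x‖ ≤ C)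
    (hlim : ∀ᵐ x ∂μ, Filter.Tendsto (fun n => f n x) Filter.atTop (𝓝 (g x))) :
    Filter.Tendsto (fun n => (hf n).toLp) Filter.atTop (𝓝 hg.toLp) := by
  rw [Lp.tendsto_Lp_iff_tendsto_eLpNorm'']
  refine tendsto_Lp_finite_of_tendsto_ae (by norm_num) (by norm_num)
    (fun n => (hf n).1) hg ?_ hlim
  refine unifIntegrable_of (by norm_num) (by norm_num) (fun n => (hf n).1) fun ε hε => ?_
  -- The threshold strictly exceeds `C`, so the truncated tails vanish almost everywhere.
  refine ⟨C.toNNReal + 1, fun n => ?_⟩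
  have : eLpNorm ({x | C.toNNReal + 1 ≤ ‖f n x‖₊}.indicator (f n)) 2 μ = 0 := by
    refine (eLpNorm_congr_ae (g := fun _ => (0 : F)) ?_).trans (by simp)
    filter_upwards [hfC n] with x hx
    refine indicator_of_notMem (fun h => ?_) _
    have h' : ((C.toNNReal + 1 : ℝ≥0) : ℝ) ≤ ‖f n x‖ := h
    push_cast at h'
    linarith [Real.le_coe_toNNReal C]
  rw [this]
  exact zero_le

instance isAddHaarMeasure_volume_spaceTime {d : ℕ} :
    (volume : Measure (SpaceTime d)).IsAddHaarMeasure :=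
  inferInstanceAs ((volume : Measure (Space d)).prod (volume : Measure ℝ)).IsAddHaarMeasure

/-! ### The space `H^{1,0}_0(Q)` -/

/-- Pointwise application of a bounded field of operators, on `L²`. -/
theorem exists_clm_of_bounded {α F F' : Type*} [MeasurableSpace α] {μ : Measure α}
    [NormedAddCommGroup F] [NormedSpace ℝ F] [NormedAddCommGroup F'] [NormedSpace ℝ F']
    {B : α → F →L[ℝ] F'} (hB : AEStronglyMeasurable B μ) {C : ℝ} (hC : ∀ᵐ x ∂μ, ‖B x‖ ≤ C) :
    ∃ A : Lp F 2 μ →L[ℝ] Lp F' 2 μ, ∀ f, A f =ᵐ[μ] fun x => B x (f x) := by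
  have hbd : ∀ f : Lp F 2 μ, ∀ᵐ x ∂μ, ‖B x (f x)‖ ≤ C * ‖f x‖ := fun f => by
    filter_upwards [hC] with x hx
    exact (B x).le_of_opNorm_le hx _
  have hm : ∀ f : Lp F 2 μ, MemLp (fun x => B x (f x)) 2 μ := fun f =>
    (Lp.memLp f).of_le_mul ((ContinuousLinearMap.id ℝ (F →L[ℝ] F')).aestronglyMeasurable_comp₂ hB
      (Lp.aestronglyMeasurable f)) (hbd f)
  let A₀ : Lp F 2 μ →ₗ[ℝ] Lp F' 2 μ :=
    { toFun := fun f => (hm f).toLp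
      map_add' := fun f g => by
        rw [← MemLp.toLp_add]
        refine MemLp.toLp_congr _ _ ?_
        filter_upwards [Lp.coeFn_add f g] with x hx
        rw [hx, Pi.add_apply, map_add]; rfl
      map_smul' := fun c f => by
        rw [RingHom.id_apply, ← MemLp.toLp_const_smul]
        refine MemLp.toLp_congr _ _ ?_
        filter_upwards [Lp.coeFn_smul c f] with x hx
        simp [hx] }
  refine ⟨A₀.mkContinuous C fun f => ?_, fun f => (hm f).coeFn_toLp⟩
  refine Lp.norm_le_mul_norm_of_ae_le_mul ?_
  filter_upwards [(hm f).coeFn_toLp, hbd f] with x hx hx'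
  rw [show (A₀ f) x = _ from hx]
  exact hx'

section H10

variable {d : ℕ} {Q : Set (SpaceTime d)}

/-- The embedding of `H^{1,0}_0(Q)` into `L²(Q)`. -/
def valL : H10 Q →L[ℝ] Lp ℝ 2 (volume.restrict Q) :=
  (WithLp.fstL 2 ℝ _ _).comp (H10 Q).subtypeL

/-- The spatial gradient as an operator from `H^{1,0}_0(Q)` to `L²(Q; ℝ^d)`. -/
def gradL : H10 Q →L[ℝ] Lp (Space d) 2 (volume.restrict Q) :=
  (WithLp.sndL 2 ℝ _ _).comp (H10 Q).subtypeL

theorem val_eq (u : H10 Q) : val u = valL u := rfl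

theorem grad_eq (u : H10 Q) : grad u = gradL u := rfl

theorem memLp_grad (u : H10 Q) : MemLp (grad u) 2 (volume.restrict Q) := Lp.memLp _

theorem H10.ext_valL_gradL {u w : H10 Q} (h1 : valL u = valL w) (h2 : gradL u = gradL w) :
    u = w :=
  Subtype.ext ((WithLp.ofLp_injective 2) (Prod.ext h1 h2))

theorem TestFun.memLp (ψ : TestFun Q) (μ : Measure (SpaceTime d)) [IsFiniteMeasureOnCompacts μ] :
    MemLp ψ.toFun 2 μ :=
  ψ.contDiff.continuous.memLp_of_hasCompactSupport ψ.hasCompactSupport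

theorem TestFun.memLp_gradX (ψ : TestFun Q) (μ : Measure (SpaceTime d))
    [IsFiniteMeasureOnCompacts μ] : MemLp (gradX ψ.toFun) 2 μ :=
  ψ.continuous_gradX.memLp_of_hasCompactSupport ψ.hasCompactSupport_gradX

theorem val_toH10 (ψ : TestFun Q) : val ψ.toH10 =ᵐ[volume.restrict Q] ψ.toFun :=
  (ψ.memLp _).coeFn_toLp

theorem grad_toH10 (ψ : TestFun Q) : grad ψ.toH10 =ᵐ[volume.restrict Q] gradX ψ.toFun :=
  (ψ.memLp_gradX _).coeFn_toLp

/-- The sum of two test functions. -/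
def TestFun.add (ψ ζ : TestFun Q) : TestFun Q where
  toFun := fun p => ψ.toFun p + ζ.toFun p
  contDiff := ψ.contDiff.add ζ.contDiff
  hasCompactSupport := ψ.hasCompactSupport.add ζ.hasCompactSupport
  tsupport_subset := (tsupport_add _ _).trans (union_subset ψ.tsupport_subset ζ.tsupport_subset)

/-- A multiple of a test function. -/
def TestFun.smul (c : ℝ) (ψ : TestFun Q) : TestFun Q where
  toFun := fun p => c * ψ.toFun p
  contDiff := contDiff_const.mul ψ.contDiff
  hasCompactSupport := ψ.hasCompactSupport.mul_left
  tsupport_subset := (tsupport_mul_subset_right (f := fun _ => c)).trans ψ.tsupport_subset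

theorem TestFun.toGraph_add (ψ ζ : TestFun Q) :
    (ψ.add ζ).toGraph = ψ.toGraph + ζ.toGraph := by
  refine WithLp.ofLp_injective 2 (Prod.ext ?_ ?_)
  · exact MemLp.toLp_add (ψ.memLp _) (ζ.memLp _)
  · refine Eq.trans
      (MemLp.toLp_congr ((ψ.add ζ).memLp_gradX _) ((ψ.memLp_gradX _).add (ζ.memLp_gradX _))
        (Filter.Eventually.of_forall fun p => ?_))
        (MemLp.toLp_add (ψ.memLp_gradX _) (ζ.memLp_gradX _))
    have : fderiv ℝ (ψ.add ζ).toFun p = fderiv ℝ ψ.toFun p + fderiv ℝ ζ.toFun p :=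
      fderiv_fun_add (ψ.contDiff.differentiable one_ne_zero p)
        (ζ.contDiff.differentiable one_ne_zero p)
    simp [TestFun.gradX_eq, this]

theorem TestFun.toGraph_smul (c : ℝ) (ψ : TestFun Q) :
    (ψ.smul c).toGraph = c • ψ.toGraph := by
  refine WithLp.ofLp_injective 2 (Prod.ext ?_ ?_)
  · exact MemLp.toLp_const_smul c (ψ.memLp _)
  · refine Eq.trans
      (MemLp.toLp_congr ((ψ.smul c).memLp_gradX _) ((ψ.memLp_gradX _).const_smul c)
        (Filter.Eventually.of_forall fun p => ?_))
        (MemLp.toLp_const_smul c (ψ.memLp_gradX _))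
    have : fderiv ℝ (ψ.smul c).toFun p = c • fderiv ℝ ψ.toFun p :=
      fderiv_const_mul (ψ.contDiff.differentiable one_ne_zero p) c
    simp [TestFun.gradX_eq, this]

/-- Graphs of test functions are already closed under sums and multiples, so the span can be
dropped. Closed identities on `H10 Q` may then be checked on single test functions. -/
theorem mem_closure_range_toGraph (w : H10 Q) :
    (w : GraphL2 Q) ∈ closure (range (TestFun.toGraph (Q := Q))) := by
  have hspan : (Submodule.span ℝ (range (TestFun.toGraph (Q := Q))) : Set (GraphL2 Q)) ⊆
      range TestFun.toGraph := by
    intro x hx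
    induction hx using Submodule.span_induction with
    | mem x hx => exact hx
    | zero =>
      let ζ : TestFun Q := ⟨0, contDiff_const, HasCompactSupport.zero, by simp⟩
      exact ⟨ζ.smul 0, by rw [TestFun.toGraph_smul, zero_smul]⟩
    | add x y _ _ hx hy =>
      obtain ⟨ψ, rfl⟩ := hx
      obtain ⟨ζ, rfl⟩ := hy
      exact ⟨ψ.add ζ, ψ.toGraph_add ζ⟩
    | smul c x _ hx =>
      obtain ⟨ψ, rfl⟩ := hx
      exact ⟨ψ.smul c, ψ.toGraph_smul c⟩
  exact closure_mono hspan w.2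

theorem denseRange_toH10 : DenseRange (TestFun.toH10 (Q := Q)) := by
  intro w
  rw [closure_subtype, ← range_comp]
  exact mem_closure_range_toGraph w

theorem StrongDual.ext_toH10 {g g' : StrongDual ℝ (H10 Q)}
    (h : ∀ ψ : TestFun Q, g ψ.toH10 = g' ψ.toH10) : g = g' := by
  ext w
  exact denseRange_toH10.induction_on (p := fun w => g w = g' w) w
    (isClosed_eq g.continuous g'.continuous) h

theorem TestFun.eq_zero_of_notMem (ψ : TestFun Q) {p : SpaceTime d} (hp : p ∉ Q) :
    ψ.toFun p = 0 :=
  image_eq_zero_of_notMem_tsupport fun h => hp (ψ.tsupport_subset h)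

theorem TestFun.inner_gradX (ψ : TestFun Q) (p : SpaceTime d) (e : Space d) :
    ⟪gradX ψ.toFun p, e⟫_ℝ = fderiv ℝ ψ.toFun p (e, 0) := by
  rw [ψ.gradX_eq, InnerProductSpace.toDual_symm_apply]
  rfl

theorem TestFun.continuous_inner_gradX (ψ : TestFun Q) (e : Space d) :
    Continuous fun p => ⟪gradX ψ.toFun p, e⟫_ℝ :=
  ψ.continuous_gradX.inner continuous_const

theorem TestFun.hasCompactSupport_inner_gradX (ψ : TestFun Q) (e : Space d) :
    HasCompactSupport fun p => ⟪gradX ψ.toFun p, e⟫_ℝ :=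
  ψ.hasCompactSupport_gradX.mono fun p hp => by
    rw [Function.mem_support] at hp ⊢
    exact fun h => hp (by simp [h])

theorem TestFun.integral_inner_gradX_mul (ψ ζ : TestFun Q) (e : Space d) :
    ∫ p in Q, ⟪gradX ψ.toFun p, e⟫_ℝ * ζ.toFun p =
      - ∫ p in Q, ψ.toFun p * ⟪gradX ζ.toFun p, e⟫_ℝ := by
  rw [setIntegral_eq_integral_of_forall_compl_eq_zero
      (fun p hp => by rw [ζ.eq_zero_of_notMem hp, mul_zero]),
    setIntegral_eq_integral_of_forall_compl_eq_zero
      (fun p hp => by rw [ψ.eq_zero_of_notMem hp, zero_mul])]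
  have h := integral_mul_fderiv_eq_neg_fderiv_mul_of_integrable (μ := volume) (f := ψ.toFun)
    (g := ζ.toFun) (v := ((e, 0) : SpaceTime d)) ?_ ?_ ?_
    (fun p _ => ψ.contDiff.differentiable one_ne_zero p)
    (fun p _ => ζ.contDiff.differentiable one_ne_zero p)
  · simp only [TestFun.inner_gradX]
    rw [h, neg_neg]
  · simp only [← TestFun.inner_gradX]
    exact ((ψ.continuous_inner_gradX e).mul ζ.contDiff.continuous).integrable_of_hasCompactSupport
      ζ.hasCompactSupport.mul_left
  · simp only [← TestFun.inner_gradX]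
    exact (ψ.contDiff.continuous.mul (ζ.continuous_inner_gradX e)).integrable_of_hasCompactSupport
      ψ.hasCompactSupport.mul_right
  · exact (ψ.contDiff.continuous.mul ζ.contDiff.continuous).integrable_of_hasCompactSupport
      ψ.hasCompactSupport.mul_right

/-- The second component of an element of `H^{1,0}_0(Q)` is the weak gradient of the first. -/
theorem integral_inner_grad_mul (w : H10 Q) (ζ : TestFun Q) (e : Space d) :
    ∫ p in Q, ⟪grad w p, e⟫_ℝ * ζ.toFun p = - ∫ p in Q, val w p * ⟪gradX ζ.toFun p, e⟫_ℝ := by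
  obtain ⟨A, hA⟩ := exists_clm_of_bounded (μ := volume.restrict Q)
    (B := fun _ => innerSL ℝ e) aestronglyMeasurable_const
    (C := ‖innerSL ℝ e‖) (Filter.Eventually.of_forall fun _ => le_rfl)
  let z := (ζ.memLp (volume.restrict Q)).toLp
  have hm := ((ζ.continuous_inner_gradX e).memLp_of_hasCompactSupport (p := 2)
    (μ := volume.restrict Q) (ζ.hasCompactSupport_inner_gradX e))
  have h1 : ∀ w : H10 Q, ∫ p in Q, ⟪grad w p, e⟫_ℝ * ζ.toFun p = ⟪A (gradL w), z⟫_ℝ := fun w => by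
    rw [L2.inner_def]
    refine integral_congr_ae ?_
    filter_upwards [hA (gradL w), (ζ.memLp (volume.restrict Q)).coeFn_toLp] with p hp hp'
    rw [hp, hp', grad_eq]
    simp [real_inner_comm, mul_comm]
  have h2 : ∀ w : H10 Q, ∫ p in Q, val w p * ⟪gradX ζ.toFun p, e⟫_ℝ = ⟪valL w, hm.toLp⟫_ℝ :=
    fun w => by
      rw [L2.inner_def]
      refine integral_congr_ae ?_
      filter_upwards [hm.coeFn_toLp] with p hp
      rw [hp, val_eq]
      simp [mul_comm]
  rw [h1, h2]
  refine denseRange_toH10.induction_on (p := fun w => ⟪A (gradL w), z⟫_ℝ = -⟪valL w, hm.toLp⟫_ℝ) w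
    (isClosed_eq (by fun_prop) (by fun_prop)) fun ψ => ?_
  rw [← h1, ← h2]
  have e1 := integral_congr_ae (μ := volume.restrict Q)
    (f := fun p => ⟪grad ψ.toH10 p, e⟫_ℝ * ζ.toFun p)
    (g := fun p => ⟪gradX ψ.toFun p, e⟫_ℝ * ζ.toFun p) (by
      filter_upwards [grad_toH10 ψ] with p hp
      rw [hp])
  have e2 := integral_congr_ae (μ := volume.restrict Q)
    (f := fun p => val ψ.toH10 p * ⟪gradX ζ.toFun p, e⟫_ℝ)
    (g := fun p => ψ.toFun p * ⟪gradX ζ.toFun p, e⟫_ℝ) (by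
      filter_upwards [val_toH10 ψ] with p hp
      rw [hp])
  rw [e1, e2]
  exact ψ.integral_inner_gradX_mul ζ e

/-- An element of `H^{1,0}_0(Q)` is determined by the underlying function. -/
theorem valL_injective (hQ : IsOpen Q) : Function.Injective (valL (Q := Q)) := by
  rw [injective_iff_map_eq_zero]
  intro w hw
  refine H10.ext_valL_gradL (by simpa using hw) ?_
  rw [map_zero]
  have hval : val w =ᵐ[volume.restrict Q] 0 := by
    rw [val_eq, hw]
    exact Lp.coeFn_zero _ _ _
  have hloc : LocallyIntegrableOn (grad w) Q volume :=
    locallyIntegrableOn_of_locallyIntegrable_restrict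
      ((memLp_grad w).locallyIntegrable (by norm_num))
  -- Fundamental lemma of the calculus of variations: the weak gradient of the zero function
  -- integrates to zero against every test function.
  have h := hQ.ae_eq_zero_of_integral_contDiff_smul_eq_zero hloc fun g hg hgc hgs => ?_
  · rw [Lp.eq_zero_iff_ae_eq_zero]
    exact (ae_restrict_iff' hQ.measurableSet).2 h
  · let ζ : TestFun Q := ⟨g, hg.of_le (by exact_mod_cast le_top), hgc, hgs⟩
    have hint : Integrable (fun p => ζ.toFun p • grad w p) (volume.restrict Q) :=
      memLp_one_iff_integrable.1 ((memLp_grad w).smul (ζ.memLp _))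
    rw [← setIntegral_eq_integral_of_forall_compl_eq_zero (s := Q)
      (fun p hp => by rw [show g p = 0 from ζ.eq_zero_of_notMem hp, zero_smul])]
    refine ext_inner_left ℝ fun e => ?_
    rw [inner_zero_right, ← integral_inner hint]
    have h1 := integral_inner_grad_mul w ζ e
    rw [integral_eq_zero_of_ae (f := fun p => val w p * _) (by
      filter_upwards [hval] with p hp
      simp [hp]), neg_zero] at h1
    rw [← h1]
    refine integral_congr_ae (Filter.Eventually.of_forall fun p => ?_)
    simp [inner_smul_right, real_inner_comm, mul_comm]

theorem eq_of_val_ae_eq (hQ : IsOpen Q) {u w : H10 Q}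
    (h : val u =ᵐ[volume.restrict Q] val w) : u = w :=
  valL_injective hQ (Lp.ext h)

end H10

/-! ### Bounded operators representing the first and second order forms. -/

section Forms

variable {d : ℕ} {Q : Set (SpaceTime d)}

/-- The first order form `∫ (β · ∇u) w` through a bounded operator on `L²`. -/
theorem exists_convection_clm {β : SpaceTime d → Space d}
    (hβ : AEStronglyMeasurable β (volume.restrict Q)) {C : ℝ}
    (hC : ∀ᵐ p ∂volume.restrict Q, ‖β p‖ ≤ C) :
    ∃ A : Lp (Space d) 2 (volume.restrict Q) →L[ℝ] Lp ℝ 2 (volume.restrict Q), ∀ u w : H10 Q,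
      Integrable (fun p => ⟪β p, grad u p⟫_ℝ * val w p) (volume.restrict Q) ∧
      ∫ p in Q, ⟪β p, grad u p⟫_ℝ * val w p = ⟪valL w, A (gradL u)⟫_ℝ := by
  obtain ⟨A, hA⟩ := exists_clm_of_bounded (B := fun p => innerSL ℝ (β p))
    ((innerSL ℝ (E := Space d)).continuous.comp_aestronglyMeasurable hβ) (C := C) (by
      filter_upwards [hC] with p hp
      rwa [innerSL_apply_norm])
  refine ⟨A, fun u w => ?_⟩
  have h : (fun p => ⟪(valL w) p, A (gradL u) p⟫_ℝ) =ᵐ[volume.restrict Q]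
      fun p => ⟪β p, grad u p⟫_ℝ * val w p := by
    filter_upwards [hA (gradL u)] with p hp
    rw [hp, grad_eq, val_eq]
    simp
  exact ⟨(L2.integrable_inner (𝕜 := ℝ) (valL w) (A (gradL u))).congr h,
    by rw [L2.inner_def, integral_congr_ae h]⟩

/-- The second order form `∫ k ∇u · ∇w` through a bounded operator on `L²`. -/
theorem exists_diffusion_clm {k : SpaceTime d → ℝ}
    (hk : AEStronglyMeasurable k (volume.restrict Q)) {C : ℝ}
    (hC : ∀ᵐ p ∂volume.restrict Q, ‖k p‖ ≤ C) :
    ∃ A : Lp (Space d) 2 (volume.restrict Q) →L[ℝ] Lp (Space d) 2 (volume.restrict Q),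
      ∀ u w : H10 Q,
      Integrable (fun p => k p * ⟪grad u p, grad w p⟫_ℝ) (volume.restrict Q) ∧
      ∫ p in Q, k p * ⟪grad u p, grad w p⟫_ℝ = ⟪gradL w, A (gradL u)⟫_ℝ := by
  obtain ⟨A, hA⟩ := exists_clm_of_bounded
    (B := fun p => k p • ContinuousLinearMap.id ℝ (Space d))
    (hk.smul_const _) (C := C * ‖ContinuousLinearMap.id ℝ (Space d)‖) (by
      filter_upwards [hC] with p hp
      rw [norm_smul]
      gcongr)
  refine ⟨A, fun u w => ?_⟩
  have h : (fun p => ⟪(gradL w) p, A (gradL u) p⟫_ℝ) =ᵐ[volume.restrict Q]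
      fun p => k p * ⟪grad u p, grad w p⟫_ℝ := by
    filter_upwards [hA (gradL u)] with p hp
    rw [hp, grad_eq, grad_eq]
    rw [smul_apply, ContinuousLinearMap.id_apply, real_inner_smul_right,
      real_inner_comm]
  exact ⟨(L2.integrable_inner (𝕜 := ℝ) (gradL w) (A (gradL u))).congr h,
    by rw [L2.inner_def, integral_congr_ae h]⟩

theorem inner_valL_self (w : H10 Q) : ⟪valL w, valL w⟫_ℝ = ∫ p in Q, val w p ^ 2 := by
  rw [L2.inner_def]
  refine integral_congr_ae (Filter.Eventually.of_forall fun p => ?_)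
  simp [val_eq, sq]

end Forms

/-! ### Integration by parts against a vector field of constant divergence -/

theorem integral_fderiv_apply_eq_zero {E : Type*} [NormedAddCommGroup E] [NormedSpace ℝ E]
    [FiniteDimensional ℝ E] [MeasurableSpace E] [BorelSpace E] (μ : Measure E)
    [μ.IsAddHaarMeasure] {f : E → ℝ} (hf : ContDiff ℝ 1 f) (hfc : HasCompactSupport f) (v : E) :
    ∫ x, fderiv ℝ f x v ∂μ = 0 := by
  have hi : Integrable (fun x => fderiv ℝ f x v) μ :=
    ((hf.continuous_fderiv one_ne_zero).clm_apply continuous_const).integrable_of_hasCompactSupport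
      (hfc.fderiv_apply ℝ v)
  have h := integral_mul_fderiv_eq_neg_fderiv_mul_of_integrable (μ := μ) (f := fun _ => (1 : ℝ))
    (g := f) (v := v) (by simp) (by simpa using hi)
    (by simpa using hf.continuous.integrable_of_hasCompactSupport hfc)
    (fun x _ => differentiableAt_const _) (fun x _ => hf.differentiable one_ne_zero x)
  simpa using h

/-- The field `g ^ 2 • β` is compactly supported in `Ω`, and its divergence `c * g ^ 2 + 2 * g * ⟪β,
∇g⟫` integrates to zero. The factor `g ^ 2` also extends the field by zero from `Ω` to the whole
space. -/
theorem integral_inner_gradient_mul_self {d : ℕ} {Ω : Set (Space d)} (hΩ : IsOpen Ω)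
    {β : Space d → Space d} (hβ : ContDiffOn ℝ 1 β Ω) {c : ℝ}
    (hdiv : ∀ x ∈ Ω, ∑ i, (fderiv ℝ β x (EuclideanSpace.single i 1)) i = c) {g : Space d → ℝ}
    (hg : ContDiff ℝ 1 g) (hgc : HasCompactSupport g) (hgs : tsupport g ⊆ Ω) :
    ∫ x in Ω, ⟪β x, gradient g x⟫_ℝ * g x = -(c / 2) * ∫ x in Ω, g x ^ 2 := by
  have hg0 : ∀ x, x ∉ Ω → g x = 0 := fun x hx =>
    image_eq_zero_of_notMem_tsupport fun h => hx (hgs h)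
  rw [setIntegral_eq_integral_of_forall_compl_eq_zero
      (fun x hx => by rw [hg0 x hx, mul_zero]),
    setIntegral_eq_integral_of_forall_compl_eq_zero
      (fun x hx => by rw [hg0 x hx, zero_pow two_ne_zero])]
  set F : Space d → Space d := fun x => g x ^ 2 • β x with hF
  have hF0 : ∀ x, x ∉ tsupport g → F =ᶠ[𝓝 x] fun _ => 0 := fun x hx => by
    filter_upwards [(isClosed_tsupport g).isOpen_compl.mem_nhds hx] with y hy
    simp [hF, image_eq_zero_of_notMem_tsupport hy]
  have hFc : ContDiff ℝ 1 F := by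
    rw [contDiff_iff_contDiffAt]
    intro x
    by_cases hx : x ∈ tsupport g
    · exact (hg.contDiffAt.pow 2).smul (hβ.contDiffAt (hΩ.mem_nhds (hgs hx)))
    · exact contDiffAt_const.congr_of_eventuallyEq (hF0 x hx)
  have hFs : HasCompactSupport F := hgc.mono fun x hx => by
    rw [Function.mem_support] at hx ⊢
    exact fun h => hx (by simp [hF, h])
  have hFi : ∀ i, ContDiff ℝ 1 fun x => F x i := fun i =>
    (EuclideanSpace.proj (𝕜 := ℝ) i).contDiff.comp hFc
  have hFis : ∀ i, HasCompactSupport fun x => F x i := fun i =>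
    hFs.comp_left (g := fun y : Space d => y i) rfl
  have hfd : ∀ i x v, fderiv ℝ (fun x => F x i) x v = (fderiv ℝ F x v) i := fun i x v => by
    have := ((EuclideanSpace.proj (𝕜 := ℝ) i).hasFDerivAt (x := F x)).comp x
      (hFc.differentiable one_ne_zero x).hasFDerivAt
    rw [show (fun x => F x i) = (EuclideanSpace.proj (𝕜 := ℝ) i) ∘ F from rfl, this.fderiv]
    rfl
  have hpt : ∀ x, ⟪β x, gradient g x⟫_ℝ * g x =
      (1 / 2) * ∑ i, fderiv ℝ (fun x => F x i) x (EuclideanSpace.single i 1)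
        - (c / 2) * g x ^ 2 := by
    intro x
    by_cases hx : x ∈ tsupport g
    · have hxΩ := hgs hx
      have hβd := (hβ.contDiffAt (hΩ.mem_nhds hxΩ)).differentiableAt one_ne_zero
      have hgd := hg.differentiable one_ne_zero x
      have hFd := ((hgd.hasFDerivAt.pow 2).smul hβd.hasFDerivAt).fderiv
      have hgr : ⟪β x, gradient g x⟫_ℝ =
          ∑ i, β x i * fderiv ℝ g x (EuclideanSpace.single i 1) := by
        rw [real_inner_comm, gradient, InnerProductSpace.toDual_symm_apply]
        conv_lhs => rw [← (EuclideanSpace.basisFun (Fin d) ℝ).sum_repr (β x)]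
        simp [map_sum]
      have hs : ∀ i, fderiv ℝ (fun x => F x i) x (EuclideanSpace.single i 1) =
          g x ^ 2 * (fderiv ℝ β x (EuclideanSpace.single i 1)) i +
            2 * g x * (β x i * fderiv ℝ g x (EuclideanSpace.single i 1)) := fun i => by
        rw [hfd]
        have : fderiv ℝ F x = _ := hFd
        rw [this]
        simp
        ring
      rw [Finset.sum_congr rfl fun i _ => hs i, Finset.sum_add_distrib, ← Finset.mul_sum,
        ← Finset.mul_sum, hdiv x hxΩ, ← hgr]
      ring
    · have h0 : g x = 0 := image_eq_zero_of_notMem_tsupport hx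
      have hz : ∀ i v, fderiv ℝ (fun x => F x i) x v = 0 := fun i v => by
        rw [hfd, (hF0 x hx).fderiv_eq]
        simp
      simp [h0, hz]
  have hint : ∀ i, Integrable fun x => fderiv ℝ (fun x => F x i) x (EuclideanSpace.single i 1) :=
    fun i => (((hFi i).continuous_fderiv one_ne_zero).clm_apply
      continuous_const).integrable_of_hasCompactSupport ((hFis i).fderiv_apply ℝ _)
  have hg2c : HasCompactSupport fun x => g x ^ 2 := hgc.mono fun x hx => by
    rw [Function.mem_support] at hx ⊢
    exact fun h => hx (by simp [h])
  have hg2 : Integrable fun x => g x ^ 2 := Continuous.integrable_of_hasCompactSupport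
    (hg.continuous.pow 2) hg2c
  rw [integral_congr_ae (Filter.Eventually.of_forall hpt),
    integral_sub ((integrable_finsetSum _ fun i _ => hint i).const_mul _) (hg2.const_mul _),
    integral_const_mul, integral_const_mul, integral_finsetSum _ fun i _ => hint i,
    Finset.sum_eq_zero fun i _ => integral_fderiv_apply_eq_zero volume (hFi i) (hFis i) _]
  ring

section Cylinder

variable {d : ℕ} {Ω : Set (Space d)} {a b : ℝ}

theorem volume_restrict_cylinder (Ω : Set (Space d)) (a b : ℝ) :
    (volume : Measure (SpaceTime d)).restrict (Ω ×ˢ Ioo a b) =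
      (volume.restrict Ω).prod (volume.restrict (Ioo a b)) :=
  (Measure.prod_restrict _ _).symm

theorem TestFun.slice (ψ : TestFun (Ω ×ˢ Ioo a b)) (t : ℝ) :
    ContDiff ℝ 1 (fun x => ψ.toFun (x, t)) ∧ HasCompactSupport (fun x => ψ.toFun (x, t)) ∧
      tsupport (fun x => ψ.toFun (x, t)) ⊆ Ω := by
  have hsub : tsupport (fun x => ψ.toFun (x, t)) ⊆ Prod.fst '' tsupport ψ.toFun := by
    refine closure_minimal (fun x hx => ⟨(x, t), subset_tsupport _ hx, rfl⟩) ?_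
    exact (ψ.hasCompactSupport.isCompact.image continuous_fst).isClosed
  refine ⟨ψ.contDiff.comp (contDiff_id.prodMk contDiff_const), ?_, ?_⟩
  · exact (ψ.hasCompactSupport.isCompact.image continuous_fst).of_isClosed_subset
      (isClosed_tsupport _) hsub
  · rintro x hx
    obtain ⟨p, hp, rfl⟩ := hsub hx
    exact (ψ.tsupport_subset hp).1

/-- Integration by parts in `H^{1,0}_0` of a cylinder against a bounded vector field whose spatial
divergence is constant. -/
theorem integral_inner_grad_mul_val (hΩ : IsOpen Ω) {β : SpaceTime d → Space d}
    (hβm : AEStronglyMeasurable β (volume.restrict (Ω ×ˢ Ioo a b))) {C : ℝ}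
    (hC : ∀ p ∈ Ω ×ˢ Ioo a b, ‖β p‖ ≤ C)
    (hβ : ∀ t ∈ Ioo a b, ContDiffOn ℝ 1 (fun x => β (x, t)) Ω) {c : ℝ}
    (hdiv : ∀ x ∈ Ω, ∀ t ∈ Ioo a b,
      ∑ i, (fderiv ℝ (fun x => β (x, t)) x (EuclideanSpace.single i 1)) i = c)
    (w : H10 (Ω ×ˢ Ioo a b)) :
    ∫ p in Ω ×ˢ Ioo a b, ⟪β p, grad w p⟫_ℝ * val w p =
      -(c / 2) * ∫ p in Ω ×ˢ Ioo a b, val w p ^ 2 := by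
  have hCae : ∀ᵐ p ∂volume.restrict (Ω ×ˢ Ioo a b), ‖β p‖ ≤ C :=
    (ae_restrict_iff' (hΩ.prod isOpen_Ioo).measurableSet).2 (Filter.Eventually.of_forall hC)
  obtain ⟨A, hA⟩ := exists_convection_clm hβm hCae
  rw [(hA w w).2, ← inner_valL_self]
  refine denseRange_toH10.induction_on
    (p := fun w => ⟪valL w, A (gradL w)⟫_ℝ = -(c / 2) * ⟪valL w, valL w⟫_ℝ) w
    (isClosed_eq (by fun_prop) (by fun_prop)) fun ψ => ?_
  rw [← (hA _ _).2, inner_valL_self]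
  have e1 : (fun p => ⟪β p, grad ψ.toH10 p⟫_ℝ * val ψ.toH10 p) =ᵐ[volume.restrict (Ω ×ˢ Ioo a b)]
      fun p => ⟪β p, gradX ψ.toFun p⟫_ℝ * ψ.toFun p := by
    filter_upwards [grad_toH10 ψ, val_toH10 ψ] with p hp hp'
    rw [hp, hp']
  have e2 : (fun p => val ψ.toH10 p ^ 2) =ᵐ[volume.restrict (Ω ×ˢ Ioo a b)]
      fun p => ψ.toFun p ^ 2 := by
    filter_upwards [val_toH10 ψ] with p hp
    rw [hp]
  have i1 := (hA ψ.toH10 ψ.toH10).1.congr e1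
  have i2 : Integrable (fun p => ψ.toFun p ^ 2) (volume.restrict (Ω ×ˢ Ioo a b)) :=
    (ψ.memLp _).integrable_sq
  rw [integral_congr_ae e1, integral_congr_ae e2]
  rw [volume_restrict_cylinder] at i1 i2 ⊢
  -- Fubini with time outermost: `β` is differentiable only in space, so the divergence theorem is
  -- applied on each time slice.
  rw [integral_prod_symm _ i1, integral_prod_symm _ i2, ← integral_const_mul]
  refine setIntegral_congr_fun measurableSet_Ioo fun t ht => ?_
  obtain ⟨h1, h2, h3⟩ := ψ.slice t
  have hgr : ∀ x, gradX ψ.toFun (x, t) = gradient (fun y => ψ.toFun (y, t)) x := fun _ => rfl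
  simp only [hgr]
  exact integral_inner_gradient_mul_self hΩ (hβ t ht) (fun x hx => hdiv x hx t ht) h1 h2 h3

/-- An element of `H^{1,0}_0` of a bounded cylinder whose gradient vanishes is zero. -/
theorem eq_zero_of_grad_eq_zero (hd : d ≠ 0) (hΩ : IsOpen Ω) (hb : Bornology.IsBounded Ω)
    {w : H10 (Ω ×ˢ Ioo a b)} (hw : gradL w = 0) : w = 0 := by
  obtain ⟨C, hC⟩ := hb.exists_norm_le
  -- The field `x` is bounded on `Ω` and has divergence `d`. With zero gradient the identity reads
  -- `0 = -(d / 2) ‖w‖²`, which replaces the Poincaré inequality.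
  have h := integral_inner_grad_mul_val (a := a) (b := b) hΩ (β := fun p => p.1) (c := d)
    continuous_fst.aestronglyMeasurable (fun p hp => hC _ hp.1) (fun t _ => contDiffOn_id)
    (fun x _ t _ => by
      have : fderiv ℝ (fun x : Space d => x) x = ContinuousLinearMap.id ℝ _ := fderiv_fun_id
      simp [this]) w
  rw [integral_eq_zero_of_ae, ← inner_valL_self] at h
  · have h0 : ⟪valL w, valL w⟫_ℝ = 0 := by
      have hd' : (d : ℝ) ≠ 0 := by exact_mod_cast hd
      have := mul_eq_zero.1 h.symm
      exact this.resolve_left (by simpa using hd')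
    exact H10.ext_valL_gradL (by simpa using inner_self_eq_zero.1 h0) (by simpa using hw)
  · have hz : grad w =ᵐ[volume.restrict (Ω ×ˢ Ioo a b)] 0 := by
      rw [grad_eq, hw]
      exact Lp.coeFn_zero _ _ _
    filter_upwards [hz] with p hp
    simp [hp]

end Cylinder

/-! ### Lipschitz functions in `H^{1,0}_0` of a bounded cylinder -/

/-- The spatial part of a covector on space-time, as a vector. -/
def spatialDual (d : ℕ) : (SpaceTime d →L[ℝ] ℝ) →L[ℝ] Space d :=
  (InnerProductSpace.toDual ℝ (Space d)).symm.toContinuousLinearEquiv.toContinuousLinearMap.comp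
    ((ContinuousLinearMap.compL ℝ (Space d) (SpaceTime d) ℝ).flip
      (ContinuousLinearMap.inl ℝ (Space d) ℝ))

section Lipschitz

variable {d : ℕ} {Ω : Set (Space d)} {T : ℝ}

theorem isBounded_cylinder (hb : Bornology.IsBounded Ω) (T : ℝ) :
    Bornology.IsBounded (Ω ×ˢ Ioo 0 T) :=
  hb.prod (Metric.isBounded_Ioo _ _)

theorem isFiniteMeasure_restrict_cylinder (hb : Bornology.IsBounded Ω) (T : ℝ) :
    IsFiniteMeasure ((volume : Measure (SpaceTime d)).restrict (Ω ×ˢ Ioo 0 T)) :=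
  ⟨by rw [Measure.restrict_apply_univ]; exact (isBounded_cylinder hb T).measure_lt_top⟩

theorem exists_bound_of_lipschitz {E : Type*} [PseudoMetricSpace E] {φ : E → ℝ} {L : ℝ≥0}
    (hφ : LipschitzWith L φ) {S : Set E} (hS : Bornology.IsBounded S) :
    ∃ C, 0 ≤ C ∧ ∀ p ∈ S, |φ p| ≤ C := by
  obtain ⟨C, hC⟩ := (hφ.isBounded_image hS).exists_norm_le
  exact ⟨max C 0, le_max_right _ _, fun p hp => (hC _ (mem_image_of_mem φ hp)).trans
    (le_max_left _ _)⟩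

theorem memLp_of_lipschitz (hΩ : IsOpen Ω) (hb : Bornology.IsBounded Ω) {φ : SpaceTime d → ℝ}
    {L : ℝ≥0} (hφ : LipschitzWith L φ) : MemLp φ 2 (volume.restrict (Ω ×ˢ Ioo 0 T)) := by
  have := isFiniteMeasure_restrict_cylinder hb T
  obtain ⟨C, -, hC⟩ := exists_bound_of_lipschitz hφ (isBounded_cylinder hb T)
  exact MemLp.of_bound hφ.continuous.aestronglyMeasurable C
    ((ae_restrict_iff' (hΩ.prod isOpen_Ioo).measurableSet).2 (Filter.Eventually.of_forall hC))

/-- Where `η (g p) ≠ 0` one has `|φ p| ≥ ε - r > 0`, a closed condition that keeps `p.1` inside `Ω`;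
together with the time cutoff it defines a compact subset of the cylinder. The cutoff `χ` is not
differentiated, since only the spatial gradient is taken. -/
theorem exists_testFun_truncation (hb : Bornology.IsBounded Ω)
    {φ g : SpaceTime d → ℝ} (hφ : Continuous φ) (h0 : ∀ x ∉ Ω, ∀ t, φ (x, t) = 0)
    (hg : ContDiff ℝ 1 g) {ε r δ : ℝ} (hr : r < ε) (hgφ : ∀ p, |g p - φ p| ≤ r) (hδ : 0 < δ)
    {χ η : ℝ → ℝ} (hχ : ContDiff ℝ 1 χ) (hχs : ∀ t, χ t ≠ 0 → t ∈ Icc δ (T - δ))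
    (hη : ContDiff ℝ 1 η) (hη0 : ∀ s, |s| ≤ ε → η s = 0) :
    ∃ ψ : TestFun (Ω ×ˢ Ioo 0 T), (∀ p, ψ.toFun p = χ p.2 * η (g p)) ∧
      ∀ p, gradX ψ.toFun p = (χ p.2 * deriv η (g p)) • spatialDual d (fderiv ℝ g p) := by
  set S : Set (SpaceTime d) := {p | p.2 ∈ Icc δ (T - δ) ∧ ε - r ≤ |φ p|} with hS
  have hSc : IsClosed S :=
    (isClosed_Icc.preimage continuous_snd).inter (isClosed_le continuous_const hφ.abs)
  have hSQ : S ⊆ Ω ×ˢ Ioo 0 T := fun p hp => by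
    refine ⟨?_, by linarith [hp.1.1], by linarith [hp.1.2]⟩
    by_contra hx
    have := hp.2
    rw [show φ p = 0 from h0 p.1 hx p.2, abs_zero] at this
    linarith
  have hScomp : IsCompact S := Metric.isCompact_of_isClosed_isBounded hSc
    ((isBounded_cylinder hb T).subset hSQ)
  have hsupp : tsupport (fun p : SpaceTime d => χ p.2 * η (g p)) ⊆ S := by
    refine closure_minimal (fun p hp => ?_) hSc
    rw [Function.mem_support] at hp
    refine ⟨hχs _ (left_ne_zero_of_mul hp), ?_⟩
    have h1 : ε < |g p| := by
      by_contra! h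
      exact right_ne_zero_of_mul hp (hη0 _ h)
    have h2 := hgφ p
    have h3 := abs_sub_abs_le_abs_sub (g p) (φ p)
    linarith
  refine ⟨⟨fun p => χ p.2 * η (g p), (hχ.comp contDiff_snd).mul (hη.comp hg),
    HasCompactSupport.intro' hScomp hSc fun p hp => image_eq_zero_of_notMem_tsupport
      (f := fun p : SpaceTime d => χ p.2 * η (g p)) fun h => hp (hsupp h), hsupp.trans hSQ⟩, fun p => rfl,
    fun p => ?_⟩
  rw [TestFun.gradX_eq]
  have d1 : HasFDerivAt (fun p : SpaceTime d => χ p.2)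
      (deriv χ p.2 • ContinuousLinearMap.snd ℝ (Space d) ℝ) p :=
    (hχ.differentiable one_ne_zero p.2).hasDerivAt.comp_hasFDerivAt p hasFDerivAt_snd
  have d2 : HasFDerivAt (fun p : SpaceTime d => η (g p)) (deriv η (g p) • fderiv ℝ g p) p :=
    (hη.differentiable one_ne_zero (g p)).hasDerivAt.comp_hasFDerivAt p
      (hg.differentiable one_ne_zero p).hasFDerivAt
  refine (congrArg (fun ℓ : SpaceTime d →L[ℝ] ℝ => (InnerProductSpace.toDual ℝ (Space d)).symm
    (ℓ.comp (ContinuousLinearMap.inl ℝ (Space d) ℝ))) (d1.mul d2).fderiv).trans ?_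
  rw [← map_smul]
  refine congrArg (InnerProductSpace.toDual ℝ (Space d)).symm ?_
  ext e
  simp [mul_assoc]

/-- A Lipschitz function that vanishes outside `Ω` belongs to `H^{1,0}_0(Ω × (0, T))`. -/
theorem exists_H10_of_lipschitz (hΩ : IsOpen Ω) (hb : Bornology.IsBounded Ω)
    {φ : SpaceTime d → ℝ} {L : ℝ≥0} (hφ : LipschitzWith L φ)
    (h0 : ∀ x ∉ Ω, ∀ t, φ (x, t) = 0) :
    ∃ u : H10 (Ω ×ˢ Ioo 0 T), val u =ᵐ[volume.restrict (Ω ×ˢ Ioo 0 T)] φ := by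
  have := isFiniteMeasure_restrict_cylinder hb T
  have hQm : MeasurableSet (Ω ×ˢ Ioo 0 T) := (hΩ.prod isOpen_Ioo).measurableSet
  obtain ⟨g, hg, hgφ, hgL, hgD⟩ := exists_smooth_approx_of_lipschitz
    (volume : Measure (SpaceTime d)) hφ
  obtain ⟨M, hM⟩ := exists_shrink
  obtain ⟨C, hC0, hC⟩ := exists_bound_of_lipschitz hφ (isBounded_cylinder hb T)
  set δ : ℕ → ℝ := fun n => 1 / ((n : ℝ) + 1) with hδ
  have hδ0 : ∀ n, 0 < δ n := fun n => by positivity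
  have hδ1 : ∀ n, δ n ≤ 1 := fun n => by
    rw [hδ]; exact div_le_one_of_le₀ (by linarith [n.cast_nonneg (α := ℝ)]) (by positivity)
  have hδt : Filter.Tendsto δ Filter.atTop (𝓝 0) := tendsto_one_div_add_atTop_nhds_zero_nat
  -- The mollification error is at most `L * δ n`. The factor `L + 1` makes the threshold strictly
  -- larger, also when `L = 0`.
  set ε : ℕ → ℝ := fun n => (L + 1) * δ n with hε
  have hL0 : (0 : ℝ) ≤ L := L.2
  have hε0 : ∀ n, 0 < ε n := fun n => mul_pos (by linarith) (hδ0 n)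
  have hεt : Filter.Tendsto ε Filter.atTop (𝓝 0) := by simpa using hδt.const_mul ((L : ℝ) + 1)
  have hrε : ∀ n, L * δ n < ε n := fun n => by
    simp only [hε]; nlinarith [hδ0 n]
  choose η hη hη0 hη1 hηs hηM using fun n => hM (ε n) (hε0 n)
  choose χ hχ hχ01 hχs hχ1 using fun n => exists_time_cutoff T (hδ0 n)
  choose ψ hψ hψg using fun n => exists_testFun_truncation (T := T) hb hφ.continuous h0 (hg n)
    (hrε n) (hgφ n) (hδ0 n) (hχ n) (hχs n) (hη n) (hη0 n)
  have hgt : ∀ p, Filter.Tendsto (fun n => g n p) Filter.atTop (𝓝 (φ p)) := fun p => by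
    rw [tendsto_iff_dist_tendsto_zero]
    refine squeeze_zero (fun _ => dist_nonneg) (fun n => hgφ n p) ?_
    simpa only [mul_zero] using hδt.const_mul (L : ℝ)
  have hev : ∀ p ∈ Ω ×ˢ Ioo 0 T, φ p ≠ 0 → ∀ᶠ n in Filter.atTop,
      χ n p.2 = 1 ∧ 2 * ε n < |g n p| := by
    intro p hp hφp
    have h1 : ∀ᶠ n in Filter.atTop, 2 * δ n < p.2 := by
      have : Filter.Tendsto (fun n => 2 * δ n) Filter.atTop (𝓝 0) := by
        simpa using hδt.const_mul 2
      exact this.eventually_lt_const hp.2.1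
    have h2 : ∀ᶠ n in Filter.atTop, 2 * δ n < T - p.2 := by
      have : Filter.Tendsto (fun n => 2 * δ n) Filter.atTop (𝓝 0) := by
        simpa using hδt.const_mul 2
      exact this.eventually_lt_const (by linarith [hp.2.2])
    have h3 : ∀ᶠ n in Filter.atTop, 2 * ε n < |g n p| := by
      have : Filter.Tendsto (fun n => 2 * ε n) Filter.atTop (𝓝 0) := by
        simpa using hεt.const_mul 2
      exact this.eventually_lt (hgt p).abs (abs_pos.2 hφp)
    filter_upwards [h1, h2, h3] with n h1 h2 h3
    exact ⟨hχ1 n _ ⟨h1.le, by linarith⟩, h3⟩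
  have hsmall : ∀ p, φ p = 0 → ∀ n, |g n p| < ε n := fun p hp n => by
    have := hgφ n p
    rw [hp, sub_zero] at this
    exact this.trans_lt (hrε n)
  classical
  -- The limit of the gradients. At a zero of `φ` every `η n` vanishes near `g n p`, so all
  -- approximants have zero gradient there, whatever the derivative of `φ` is.
  set G : SpaceTime d → Space d := fun p => if φ p = 0 then 0 else spatialDual d (fderiv ℝ φ p)
    with hG
  have hspat : ∀ ℓ : SpaceTime d →L[ℝ] ℝ, ‖ℓ‖ ≤ L → ‖spatialDual d ℓ‖ ≤ ‖spatialDual d‖ * L :=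
    fun ℓ hℓ => ((spatialDual d).le_opNorm ℓ).trans (by gcongr)
  have hGm : MemLp G 2 (volume.restrict (Ω ×ˢ Ioo 0 T)) := by
    refine MemLp.of_bound (Measurable.aestronglyMeasurable ?_) (‖spatialDual d‖ * L)
      (Filter.Eventually.of_forall fun p => ?_)
    · refine Measurable.ite (hφ.continuous.measurable (measurableSet_singleton 0))
        measurable_const ?_
      exact (spatialDual d).continuous.measurable.comp (measurable_fderiv ℝ φ)
    · simp only [hG]
      split_ifs
      · simp; positivity
      · exact hspat _ (norm_fderiv_le_of_lipschitz ℝ hφ)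
  have hφm := memLp_of_lipschitz (T := T) hΩ hb hφ
  have l1 : Filter.Tendsto (fun n => ((ψ n).memLp (volume.restrict (Ω ×ˢ Ioo 0 T))).toLp)
      Filter.atTop (𝓝 hφm.toLp) := by
    refine tendsto_toLp_of_bounded (C := C + L) _ hφm (fun n => ?_) ?_
    · refine (ae_restrict_iff' hQm).2 (Filter.Eventually.of_forall fun p hp => ?_)
      rw [hψ, Real.norm_eq_abs, abs_mul, abs_of_nonneg (hχ01 n _).1]
      have h1 : |η n (g n p)| ≤ C + L := by
        refine (hηs n _).trans ?_
        have h2 := hgφ n p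
        have h3 := abs_sub_abs_le_abs_sub (g n p) (φ p)
        have h4 := hC p hp
        have h5 : L * (1 / ((n : ℝ) + 1)) ≤ L := mul_le_of_le_one_right hL0 (hδ1 n)
        linarith
      calc χ n p.2 * |η n (g n p)| ≤ 1 * |η n (g n p)| := by
            gcongr; exact (hχ01 n _).2
        _ ≤ _ := by rwa [one_mul]
    · refine (ae_restrict_iff' hQm).2 (Filter.Eventually.of_forall fun p hp => ?_)
      simp only [hψ]
      by_cases hφp : φ p = 0
      · rw [hφp]
        refine tendsto_const_nhds.congr fun n => ?_
        rw [hη0 n _ (hsmall p hφp n).le, mul_zero]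
      · refine (hgt p).congr' ?_
        filter_upwards [hev p hp hφp] with n hn
        rw [hn.1, one_mul, hη1 n _ hn.2.le]
  have l2 : Filter.Tendsto (fun n => ((ψ n).memLp_gradX (volume.restrict (Ω ×ˢ Ioo 0 T))).toLp)
      Filter.atTop (𝓝 hGm.toLp) := by
    refine tendsto_toLp_of_bounded (C := M * (‖spatialDual d‖ * L)) _ hGm
      (fun n => Filter.Eventually.of_forall fun p => ?_) ?_
    · rw [hψg, norm_smul, Real.norm_eq_abs, abs_mul, abs_of_nonneg (hχ01 n _).1]
      have h1 : χ n p.2 * |deriv (η n) (g n p)| ≤ M := by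
        calc χ n p.2 * |deriv (η n) (g n p)| ≤ 1 * |deriv (η n) (g n p)| := by
              gcongr; exact (hχ01 n _).2
          _ ≤ M := by rw [one_mul]; exact hηM n _
      exact mul_le_mul h1 (hspat _ (hgL n p)) (norm_nonneg _)
        ((abs_nonneg _).trans (hηM n 0))
    · refine (ae_restrict_iff' hQm).2 ?_
      filter_upwards [hgD] with p hpD hp
      simp only [hψg, hG]
      split_ifs with hφp
      · refine tendsto_const_nhds.congr fun n => ?_
        have : η n =ᶠ[𝓝 (g n p)] fun _ => 0 := by
          filter_upwards [(isOpen_lt continuous_abs continuous_const).mem_nhds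
            (hsmall p hφp n)] with s hs
          exact hη0 n s (le_of_lt hs)
        rw [this.deriv_eq]
        simp
      · refine (((spatialDual d).continuous.tendsto _).comp hpD).congr' ?_
        filter_upwards [hev p hp hφp] with n hn
        have : η n =ᶠ[𝓝 (g n p)] id := by
          filter_upwards [(isOpen_lt continuous_const continuous_abs).mem_nhds hn.2] with s hs
          exact hη1 n s (le_of_lt hs)
        rw [this.deriv_eq, hn.1]
        simp
  have hlim : Filter.Tendsto (fun n => (ψ n).toGraph) Filter.atTop
      (𝓝 (WithLp.toLp 2 (hφm.toLp, hGm.toLp))) :=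
    ((WithLp.prod_continuous_toLp 2 _ _).tendsto _).comp (l1.prodMk_nhds l2)
  have hmem : WithLp.toLp 2 (hφm.toLp, hGm.toLp) ∈ H10 (Ω ×ˢ Ioo 0 T) :=
    (Submodule.isClosed_topologicalClosure _).mem_of_tendsto hlim
      (Filter.Eventually.of_forall fun n => (ψ n).toH10.2)
  exact ⟨⟨_, hmem⟩, hφm.coeFn_toLp⟩

end Lipschitz

/-! ### Time derivative and time continuity of Lipschitz functions. -/

section LipschitzTime

variable {d : ℕ} {Ω : Set (Space d)} {T : ℝ}

theorem TestFun.derivT_eq {Q : Set (SpaceTime d)} (ψ : TestFun Q) (p : SpaceTime d) :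
    derivT ψ.toFun p = fderiv ℝ ψ.toFun p (0, 1) := by
  have h1 : HasFDerivAt ψ.toFun (fderiv ℝ ψ.toFun p) (p.1, p.2) :=
    (ψ.contDiff.differentiable one_ne_zero p).hasFDerivAt
  have h2 := h1.comp_hasDerivAt p.2 ((hasDerivAt_const p.2 p.1).prodMk (hasDerivAt_id p.2))
  exact h2.deriv

theorem memLp_lineDeriv_of_lipschitz (hb : Bornology.IsBounded Ω) {φ : SpaceTime d → ℝ}
    {L : ℝ≥0} (hφ : LipschitzWith L φ) (v : SpaceTime d) :
    MemLp (fun p => lineDeriv ℝ φ p v) 2 (volume.restrict (Ω ×ˢ Ioo 0 T)) := by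
  have := isFiniteMeasure_restrict_cylinder hb T
  exact MemLp.of_bound (measurable_lineDeriv hφ.continuous).aestronglyMeasurable (L * ‖v‖)
    (Filter.Eventually.of_forall fun p => norm_lineDeriv_le_of_lipschitz ℝ hφ)

/-- The distributional time derivative of a Lipschitz function is its pointwise one. -/
theorem exists_hasTimeDeriv_of_lipschitz (hb : Bornology.IsBounded Ω) {φ : SpaceTime d → ℝ}
    {L : ℝ≥0} (hφ : LipschitzWith L φ) {u : H10 (Ω ×ˢ Ioo 0 T)}
    (hu : val u =ᵐ[volume.restrict (Ω ×ˢ Ioo 0 T)] φ) :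
    ∃ g : StrongDual ℝ (H10 (Ω ×ˢ Ioo 0 T)), HasTimeDeriv u g ∧
      ∀ w, g w = ∫ p in Ω ×ˢ Ioo 0 T, lineDeriv ℝ φ p (0, 1) * val w p := by
  have hm := memLp_lineDeriv_of_lipschitz (T := T) hb hφ (0, 1)
  have hg : ∀ w : H10 (Ω ×ˢ Ioo 0 T), ⟪hm.toLp, valL w⟫_ℝ =
      ∫ p in Ω ×ˢ Ioo 0 T, lineDeriv ℝ φ p (0, 1) * val w p := fun w => by
    rw [L2.inner_def]
    refine integral_congr_ae ?_
    filter_upwards [hm.coeFn_toLp] with p hp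
    rw [hp, val_eq]
    simp [mul_comm]
  refine ⟨(innerSL ℝ hm.toLp).comp valL, fun ψ => ?_, hg⟩
  have h1 : ((innerSL ℝ hm.toLp).comp valL) ψ.toH10 = ⟪hm.toLp, valL ψ.toH10⟫_ℝ := rfl
  rw [h1, hg]
  obtain ⟨D, hD⟩ := ContDiff.lipschitzWith_of_hasCompactSupport ψ.hasCompactSupport ψ.contDiff
    one_ne_zero
  -- Integration by parts for two Lipschitz functions, of which only the test function needs compact
  -- support.
  have h2 := hφ.integral_lineDeriv_mul_eq (μ := volume) hD ψ.hasCompactSupport (0, 1)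
  have e1 : (fun p => lineDeriv ℝ φ p (0, 1) * val ψ.toH10 p) =ᵐ[volume.restrict (Ω ×ˢ Ioo 0 T)]
      fun p => lineDeriv ℝ φ p (0, 1) * ψ.toFun p := by
    filter_upwards [val_toH10 ψ] with p hp
    rw [hp]
  have e2 : (fun p => val u p * derivT ψ.toFun p) =ᵐ[volume.restrict (Ω ×ˢ Ioo 0 T)]
      fun p => φ p * derivT ψ.toFun p := by
    filter_upwards [hu] with p hp
    rw [hp]
  have hder : ∀ p, p ∉ Ω ×ˢ Ioo 0 T → derivT ψ.toFun p = 0 := fun p hp => by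
    have : fderiv ℝ ψ.toFun p = 0 := image_eq_zero_of_notMem_tsupport fun h =>
      hp (ψ.tsupport_subset (tsupport_fderiv_subset ℝ h))
    rw [ψ.derivT_eq, this]
    rfl
  rw [integral_congr_ae e1, integral_congr_ae e2, setIntegral_eq_integral_of_forall_compl_eq_zero
      (fun p hp => by rw [ψ.eq_zero_of_notMem hp, mul_zero]),
    setIntegral_eq_integral_of_forall_compl_eq_zero
      (fun p hp => by rw [hder p hp, mul_zero]), h2, ← integral_neg]
  refine integral_congr_ae (Filter.Eventually.of_forall fun p => ?_)
  simp only
  rw [(ψ.contDiff.differentiable one_ne_zero p).lineDeriv_eq_fderiv, map_neg, ψ.derivT_eq]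
  ring

/-- A Lipschitz function is continuous in time with values in `L²(Ω)`. -/
theorem exists_continuous_slices_of_lipschitz (hΩ : IsOpen Ω) (hb : Bornology.IsBounded Ω)
    {φ : SpaceTime d → ℝ} {L : ℝ≥0} (hφ : LipschitzWith L φ) :
    ∃ w : ℝ → Lp ℝ 2 (volume.restrict Ω), Continuous w ∧
      ∀ t, w t =ᵐ[volume.restrict Ω] fun x => φ (x, t) := by
  have : IsFiniteMeasure ((volume : Measure (Space d)).restrict Ω) :=
    ⟨by rw [Measure.restrict_apply_univ]; exact hb.measure_lt_top⟩
  have hm : ∀ t, MemLp (fun x => φ (x, t)) 2 (volume.restrict Ω) := fun t => by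
    obtain ⟨C, -, hC⟩ := exists_bound_of_lipschitz hφ (hb.prod (Bornology.isBounded_singleton
      (x := t)))
    exact MemLp.of_bound (hφ.continuous.comp (by fun_prop)).aestronglyMeasurable C
      ((ae_restrict_iff' hΩ.measurableSet).2 (Filter.Eventually.of_forall fun x hx =>
        hC (x, t) ⟨hx, rfl⟩))
  refine ⟨fun t => (hm t).toLp, ?_, fun t => (hm t).coeFn_toLp⟩
  refine (LipschitzWith.of_dist_le_mul (K := measureUnivNNReal (volume.restrict Ω) ^
    (2 : ℝ≥0∞).toReal⁻¹ * L) fun s t => ?_).continuous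
  rw [dist_eq_norm, ← MemLp.toLp_sub, NNReal.coe_mul, mul_assoc]
  refine Lp.norm_le_of_ae_bound (by positivity) ?_
  filter_upwards [((hm s).sub (hm t)).coeFn_toLp] with x hx
  rw [hx]
  have := hφ.dist_le_mul (x, s) (x, t)
  rwa [Prod.dist_eq, dist_self, max_eq_right dist_nonneg, dist_eq_norm] at this

theorem ae_slice_of_ae {P : SpaceTime d → Prop}
    (h : ∀ᵐ p ∂(volume : Measure (SpaceTime d)).restrict (Ω ×ˢ Ioo 0 T), P p) :
    ∀ᵐ t ∂(volume : Measure ℝ).restrict (Ioo 0 T), ∀ᵐ x ∂(volume : Measure (Space d)).restrict Ω,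
      P (x, t) := by
  rw [volume_restrict_cylinder] at h
  exact Measure.ae_ae_of_ae_prod
    (Measure.measurePreserving_swap.quasiMeasurePreserving.ae h)

/-- The time derivative is monotone on functions with zero initial values. -/
theorem integral_lineDeriv_mul_self_nonneg (hΩ : IsOpen Ω) (hb : Bornology.IsBounded Ω)
    {φ : SpaceTime d → ℝ} {L : ℝ≥0} (hφ : LipschitzWith L φ)
    (h0 : ∀ x, ∀ t ≤ 0, φ (x, t) = 0) :
    0 ≤ ∫ p in Ω ×ˢ Ioo 0 T, lineDeriv ℝ φ p (0, 1) * φ p := by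
  have hb' := isFiniteMeasure_restrict_cylinder hb T
  have hQm : MeasurableSet (Ω ×ˢ Ioo 0 T) := (hΩ.prod isOpen_Ioo).measurableSet
  have hφm := memLp_of_lipschitz (T := T) hΩ hb hφ
  set g : SpaceTime d → ℝ := (Ω ×ˢ Ioo 0 T).indicator φ with hg
  set G : SpaceTime d → ℝ := (Ω ×ˢ Ioo 0 T).indicator fun p => φ p ^ 2 with hG
  have hgi : Integrable g := (integrable_indicator_iff hQm).2 (hφm.integrable (by norm_num))
  have hGi : Integrable G := (integrable_indicator_iff hQm).2 hφm.integrable_sq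
  have hG0 : ∀ p, 0 ≤ G p := fun p => indicator_nonneg (fun _ _ => sq_nonneg _) p
  -- Backward difference quotients: they look towards earlier times, where the zero initial values
  -- enter.
  have hlim := hφ.integral_inv_smul_sub_mul_tendsto_integral_lineDeriv_mul hgi (0, -1)
  have hneg : ∫ p, lineDeriv ℝ φ p (0, -1) * g p ≤ 0 := by
    refine le_of_tendsto hlim ?_
    filter_upwards [self_mem_nhdsWithin] with h hh
    have hh0 : (0 : ℝ) < h := hh
    set z : SpaceTime d := h • (0, -1) with hz
    -- From `(a - b) * b ≤ (a ^ 2 - b ^ 2) / 2`. The shifted point either stays in the cylinder or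
    -- has nonpositive time, where `φ` is zero. The right side integrates to zero by translation
    -- invariance.
    have hpt : ∀ p, h⁻¹ • (φ (p + z) - φ p) * g p ≤ h⁻¹ * ((1 / 2) * (G (p + z) - G p)) := by
      intro p
      rw [smul_eq_mul, mul_assoc]
      refine mul_le_mul_of_nonneg_left ?_ (inv_nonneg.2 hh0.le)
      by_cases hp : p ∈ Ω ×ˢ Ioo 0 T
      · have h1 : G p = φ p ^ 2 := indicator_of_mem hp _
        have h2 : g p = φ p := indicator_of_mem hp _
        have h3 : φ (p + z) ^ 2 ≤ G (p + z) := by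
          have hpz : p + z = (p.1, p.2 - h) := by
            ext <;> simp [hz, sub_eq_add_neg]
          by_cases ht : p.2 - h ≤ 0
          · rw [hpz, h0 _ _ ht, zero_pow two_ne_zero]
            exact hG0 _
          · have hmem : p + z ∈ Ω ×ˢ Ioo 0 T := by
              rw [hpz]
              exact ⟨hp.1, not_le.1 ht, by linarith [hp.2.2]⟩
            rw [hG, indicator_of_mem hmem]
        rw [h1, h2]
        nlinarith [sq_nonneg (φ (p + z) - φ p)]
      · have h1 : G p = 0 := indicator_of_notMem hp _
        have h2 : g p = 0 := indicator_of_notMem hp _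
        rw [h1, h2]
        linarith [hG0 (p + z)]
    have hR : Integrable fun p => h⁻¹ * ((1 / 2) * (G (p + z) - G p)) :=
      (((hGi.comp_add_right z).sub hGi).const_mul _).const_mul _
    have hR0 : ∫ p, h⁻¹ * ((1 / 2) * (G (p + z) - G p)) = 0 := by
      rw [integral_const_mul, integral_const_mul, integral_sub (hGi.comp_add_right z) hGi,
        integral_add_right_eq_self, sub_self, mul_zero, mul_zero]
    -- Without integrability the integral has the default value `0`, which satisfies the bound too.
    by_cases hi : Integrable fun p => h⁻¹ • (φ (p + z) - φ p) * g p
    · exact (integral_mono hi hR hpt).trans hR0.le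
    · exact (integral_undef hi).le
  have hsym : ∀ p, lineDeriv ℝ φ p (0, -1) = -lineDeriv ℝ φ p (0, 1) := fun p => by
    rw [← lineDeriv_neg]
    simp
  have heq : ∫ p in Ω ×ˢ Ioo 0 T, lineDeriv ℝ φ p (0, 1) * φ p =
      -∫ p, lineDeriv ℝ φ p (0, -1) * g p := by
    rw [← integral_indicator hQm, ← integral_neg]
    refine integral_congr_ae (Filter.Eventually.of_forall fun p => ?_)
    simp only [hsym]
    by_cases hp : p ∈ Ω ×ˢ Ioo 0 T
    · simp [hg, indicator_of_mem hp]
    · simp [hg, indicator_of_notMem hp]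
  rw [heq]
  linarith

end LipschitzTime

theorem AffineMap.exists_lipschitzWith {E : Type*} [NormedAddCommGroup E] [NormedSpace ℝ E]
    [FiniteDimensional ℝ E] (A : E →ᵃ[ℝ] ℝ) : ∃ L : ℝ≥0, LipschitzWith L A := by
  refine ⟨‖LinearMap.toContinuousLinearMap A.linear‖₊, LipschitzWith.of_dist_le_mul fun x y => ?_⟩
  rw [dist_eq_norm, dist_eq_norm, ← vsub_eq_sub, ← vsub_eq_sub, ← A.linearMap_vsub]
  exact (LinearMap.toContinuousLinearMap A.linear).le_opNorm _

namespace InterfaceData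

variable {d : ℕ} {P : InterfaceData d} {𝒯 : Geometry.SimplicialComplex ℝ (SpaceTime d)}

theorem IsAdmissible.isOpen_QT (hP : P.IsAdmissible) : IsOpen P.QT := hP.isOpen.prod isOpen_Ioo

theorem IsAdmissible.closure_QT (hP : P.IsAdmissible) :
    closure P.QT = closure P.Ω ×ˢ Icc 0 P.T := by
  rw [QT, closure_prod_eq, closure_Ioo hP.T_pos.ne]

theorem IsFittedMesh.finite_elements (h𝒯 : P.IsFittedMesh 𝒯) : (elements 𝒯).Finite :=
  h𝒯.finite.subset fun _ hs => hs.1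

theorem IsFittedMesh.exists_element (h𝒯 : P.IsFittedMesh 𝒯) {p : SpaceTime d}
    (hp : p ∈ closure P.QT) : ∃ K ∈ elements 𝒯, p ∈ convexHull ℝ (K : Set (SpaceTime d)) := by
  rw [← h𝒯.space_eq, Geometry.SimplicialComplex.mem_space_iff] at hp
  obtain ⟨s, hs, hps⟩ := hp
  obtain ⟨K, hK, hsK⟩ := h𝒯.pure s hs
  exact ⟨K, hK, convexHull_mono (Finset.coe_subset.2 hsK) hps⟩

theorem IsFittedMesh.convexHull_subset (h𝒯 : P.IsFittedMesh 𝒯) {K : Finset (SpaceTime d)}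
    (hK : K ∈ 𝒯.faces) : convexHull ℝ (K : Set (SpaceTime d)) ⊆ closure P.QT := by
  rw [← h𝒯.space_eq]
  exact fun p hp => Geometry.SimplicialComplex.mem_space_iff.2 ⟨K, hK, hp⟩

theorem isClosed_convexHull_finset (K : Finset (SpaceTime d)) :
    IsClosed (convexHull ℝ (K : Set (SpaceTime d))) :=
  (K.finite_toSet.isCompact_convexHull ℝ).isClosed

/-! ### Finite element functions -/

/-- The lateral condition is imposed only for `0 < t < T`; continuity in time carries it to the end
edges. -/
theorem IsFEFun.eq_zero_of_notMem (hP : P.IsAdmissible) {φ : SpaceTime d → ℝ}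
    (hφ : P.IsFEFun 𝒯 φ) {p : SpaceTime d} (hp : p ∈ closure P.QT) (hpΩ : p.1 ∉ P.Ω) :
    φ p = 0 := by
  rw [hP.closure_QT] at hp
  have hfr : p.1 ∈ frontier P.Ω := by
    rw [hP.isOpen.frontier_eq]
    exact ⟨hp.1, hpΩ⟩
  have hc : ContinuousOn (fun t => φ (p.1, t)) (Icc 0 P.T) :=
    hφ.continuousOn.comp (by fun_prop) fun t ht => by
      rw [hP.closure_QT]
      exact ⟨hp.1, ht⟩
  exact EqOn.of_subset_closure (s := Ioo 0 P.T) (g := fun _ => (0 : ℝ))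
    (fun t ht => hφ.zero_lateral p.1 hfr t ht) hc continuousOn_const Ioo_subset_Icc_self
    (closure_Ioo hP.T_pos.ne).ge hp.2

/-- A finite element function is the restriction of a Lipschitz function on the whole space that
vanishes outside `Ω` and for nonpositive times. -/
theorem IsFEFun.exists_lipschitz (hP : P.IsAdmissible) (h𝒯 : P.IsFittedMesh 𝒯)
    {φ : SpaceTime d → ℝ} (hφ : P.IsFEFun 𝒯 φ) :
    ∃ (Φ : SpaceTime d → ℝ) (L : ℝ≥0), LipschitzWith L Φ ∧ (∀ x ∉ P.Ω, ∀ t, Φ (x, t) = 0) ∧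
      (∀ x, ∀ t ≤ 0, Φ (x, t) = 0) ∧ EqOn Φ φ P.QT := by
  classical
  set f : SpaceTime d → ℝ := fun p => if p.1 ∈ P.Ω then φ p else 0 with hf
  have hfφ : ∀ p ∈ closure P.QT, f p = φ p := fun p hp => by
    by_cases hpΩ : p.1 ∈ P.Ω
    · simp [hf, hpΩ]
    · simp [hf, hpΩ, hφ.eq_zero_of_notMem hP hp hpΩ]
  have hfin : Finite (elements 𝒯) := h𝒯.finite_elements.to_subtype
  have hLK : ∀ K : elements 𝒯, ∃ L : ℝ≥0,
      LipschitzOnWith L f (convexHull ℝ ((K : Finset (SpaceTime d)) : Set (SpaceTime d))) := by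
    intro K
    obtain ⟨A, hA⟩ := hφ.affine K K.2
    obtain ⟨L, hL⟩ := AffineMap.exists_lipschitzWith A
    refine ⟨L, LipschitzOnWith.of_dist_le_mul fun p hp q hq => ?_⟩
    rw [hfφ p (h𝒯.convexHull_subset K.2.1 hp), hfφ q (h𝒯.convexHull_subset K.2.1 hq), hA hp, hA hq]
    exact hL.dist_le_mul p q
  choose LK hLK using hLK
  obtain ⟨L, hL⟩ := Finite.exists_le LK
  have hlip : LipschitzOnWith L f (univ ×ˢ Icc 0 P.T) := by
    -- The cylinder need not be convex, but the slab is. The complement of `Ω`, where `f` vanishes,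
    -- joins the elements as one more closed piece.
    refine lipschitzOnWith_of_finite_closed_cover (convex_univ.prod (convex_Icc _ _))
      (F := fun o : Option (elements 𝒯) => o.elim (Prod.fst ⁻¹' P.Ωᶜ)
        fun K => convexHull ℝ ((K : Finset (SpaceTime d)) : Set (SpaceTime d))) ?_ ?_ ?_
    · rintro (_ | K)
      · exact hP.isOpen.isClosed_compl.preimage continuous_fst
      · exact isClosed_convexHull_finset _
    · intro p hp
      rw [mem_iUnion]
      by_cases hpΩ : p.1 ∈ P.Ω
      · obtain ⟨K, hK, hpK⟩ := h𝒯.exists_element (p := p) (by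
          rw [hP.closure_QT]
          exact ⟨subset_closure hpΩ, hp.2⟩)
        exact ⟨some ⟨K, hK⟩, hpK⟩
      · exact ⟨none, hpΩ⟩
    · rintro (_ | K)
      · refine LipschitzOnWith.of_dist_le_mul fun p hp q hq => ?_
        have h1 : f p = 0 := if_neg hp.1
        have h2 : f q = 0 := if_neg hq.1
        rw [h1, h2, dist_self]
        positivity
      · exact ((hLK K).weaken (hL K)).mono inter_subset_left
  -- Clamping time to `[0, T]` is a 1-Lipschitz retraction onto the slab; nonpositive times land on
  -- the initial slice.
  set c : SpaceTime d → SpaceTime d := fun p => (p.1, max (min p.2 P.T) 0) with hc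
  have hclip : LipschitzWith 1 c := by
    have := (LipschitzWith.prod_fst (α := Space d) (β := ℝ)).prodMk
      ((LipschitzWith.prod_snd.min_const P.T).max_const 0)
    rwa [max_self] at this
  have hcS : ∀ p, c p ∈ (univ : Set (Space d)) ×ˢ Icc 0 P.T := fun p =>
    ⟨mem_univ _, le_max_right _ _, max_le (min_le_right _ _) hP.T_pos.le⟩
  refine ⟨fun p => f (c p), L, ?_, fun x hx t => if_neg hx, fun x t ht => ?_, fun p hp => ?_⟩
  · refine LipschitzWith.of_dist_le_mul fun p q => ?_
    refine (hlip.dist_le_mul _ (hcS p) _ (hcS q)).trans ?_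
    have := hclip.dist_le_mul p q
    rw [NNReal.coe_one, one_mul] at this
    gcongr
  · have hct : c (x, t) = (x, 0) := by
      simp only [hc, Prod.mk.injEq, true_and]
      exact max_eq_right ((min_le_left _ _).trans ht)
    simp only [hct, hf]
    split_ifs with hx
    · exact hφ.zero_initial x hx
    · rfl
  · have hcp : c p = p := by
      simp only [hc]
      rw [min_eq_left hp.2.2.le, max_eq_left hp.2.1.le]
    simp only [hcp]
    exact hfφ p (subset_closure hp)

theorem IsFEFun.exists_lipschitz_ae (hP : P.IsAdmissible) (h𝒯 : P.IsFittedMesh 𝒯)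
    {φ : SpaceTime d → ℝ} (hφ : P.IsFEFun 𝒯 φ) :
    ∃ (Φ : SpaceTime d → ℝ) (L : ℝ≥0), LipschitzWith L Φ ∧ (∀ x ∉ P.Ω, ∀ t, Φ (x, t) = 0) ∧
      (∀ x, ∀ t ≤ 0, Φ (x, t) = 0) ∧ Φ =ᵐ[volume.restrict P.QT] φ := by
  obtain ⟨Φ, L, h1, h2, h3, h4⟩ := hφ.exists_lipschitz hP h𝒯
  exact ⟨Φ, L, h1, h2, h3, (ae_restrict_iff' hP.isOpen_QT.measurableSet).2
    (Filter.Eventually.of_forall h4)⟩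

theorem IsFEFun.exists_mem_X₀ (hP : P.IsAdmissible) (h𝒯 : P.IsFittedMesh 𝒯)
    {φ : SpaceTime d → ℝ} (hφ : P.IsFEFun 𝒯 φ) :
    ∃ u ∈ P.X₀, val u =ᵐ[volume.restrict P.QT] φ := by
  obtain ⟨Φ, L, hL, hΩ, h0, hae⟩ := hφ.exists_lipschitz_ae hP h𝒯
  obtain ⟨u, hu⟩ := exists_H10_of_lipschitz (T := P.T) hP.isOpen hP.isBounded hL hΩ
  obtain ⟨g, hg, -⟩ := exists_hasTimeDeriv_of_lipschitz hP.isBounded hL hu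
  obtain ⟨w, hw, hwΦ⟩ := exists_continuous_slices_of_lipschitz hP.isOpen hP.isBounded hL
  refine ⟨u, ⟨⟨g, hg⟩, w, hw.continuousOn, ?_, ?_⟩, hu.trans hae⟩
  · rw [Lp.eq_zero_iff_ae_eq_zero]
    filter_upwards [hwΦ 0] with x hx
    rw [hx, h0 x 0 le_rfl]
    rfl
  · filter_upwards [ae_slice_of_ae hu] with t ht
    filter_upwards [ht, hwΦ t] with x h1 h2
    exact h2.trans h1.symm

/-- `⟨∂_t u, u⟩` is nonnegative on finite element functions. -/
theorem IsFEFun.hasTimeDeriv_self_nonneg (hP : P.IsAdmissible) (h𝒯 : P.IsFittedMesh 𝒯)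
    {φ : SpaceTime d → ℝ} (hφ : P.IsFEFun 𝒯 φ) {u : P.Y}
    (hu : val u =ᵐ[volume.restrict P.QT] φ) {g : StrongDual ℝ P.Y} (hg : HasTimeDeriv u g) :
    0 ≤ g u := by
  obtain ⟨Φ, L, hL, -, h0, hae⟩ := hφ.exists_lipschitz_ae hP h𝒯
  have huΦ := hu.trans hae.symm
  obtain ⟨g', hg', hval⟩ := exists_hasTimeDeriv_of_lipschitz (T := P.T) hP.isBounded hL huΦ
  have hgg : g = g' := StrongDual.ext_toH10 fun ψ => (hg ψ).trans (hg' ψ).symm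
  rw [hgg]
  refine (integral_lineDeriv_mul_self_nonneg (T := P.T) hP.isOpen hP.isBounded hL h0).trans_eq ?_
  refine Eq.trans (integral_congr_ae ?_) (hval u).symm
  filter_upwards [huΦ] with p hp
  exact congrArg (lineDeriv ℝ Φ p (0, 1) * ·) hp.symm

/-- The space of finite element functions. -/
def feSpace (P : InterfaceData d) (𝒯 : Geometry.SimplicialComplex ℝ (SpaceTime d)) :
    Submodule ℝ (SpaceTime d → ℝ) where
  carrier := {φ | P.IsFEFun 𝒯 φ}
  zero_mem' := ⟨continuousOn_const, fun _ _ => ⟨0, fun _ _ => rfl⟩, fun _ _ _ _ => rfl,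
    fun _ _ => rfl⟩
  add_mem' := fun {φ ζ} hφ hζ => ⟨hφ.continuousOn.add hζ.continuousOn, fun K hK => by
      obtain ⟨A, hA⟩ := hφ.affine K hK
      obtain ⟨B, hB⟩ := hζ.affine K hK
      exact ⟨A + B, fun p hp => by simp [hA hp, hB hp]⟩,
    fun x hx t ht => by simp [hφ.zero_lateral x hx t ht, hζ.zero_lateral x hx t ht],
    fun x hx => by simp [hφ.zero_initial x hx, hζ.zero_initial x hx]⟩
  smul_mem' := fun c φ hφ => ⟨hφ.continuousOn.const_smul c, fun K hK => by
      obtain ⟨A, hA⟩ := hφ.affine K hK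
      exact ⟨c • A, fun p hp => by simp [hA hp]⟩,
    fun x hx t ht => by simp [hφ.zero_lateral x hx t ht],
    fun x hx => by simp [hφ.zero_initial x hx]⟩

/-- `V_h` is a finite-dimensional subspace of `Y`. -/
theorem exists_submodule_eq_Vh (hP : P.IsAdmissible) (h𝒯 : P.IsFittedMesh 𝒯) :
    ∃ V : Submodule ℝ P.Y, (V : Set P.Y) = P.Vh 𝒯 ∧ FiniteDimensional ℝ V := by
  choose S _ hS using fun φ : feSpace P 𝒯 =>
    IsFEFun.exists_mem_X₀ hP h𝒯 (show P.IsFEFun 𝒯 φ from φ.2)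
  let Sₗ : feSpace P 𝒯 →ₗ[ℝ] P.Y :=
    { toFun := S
      map_add' := fun φ ζ => eq_of_val_ae_eq hP.isOpen_QT (by
        have h : val (S φ + S ζ) =ᵐ[volume.restrict P.QT] val (S φ) + val (S ζ) := by
          rw [val_eq, map_add]
          exact Lp.coeFn_add _ _
        filter_upwards [h, hS (φ + ζ), hS φ, hS ζ] with p h1 h2 h3 h4
        simp [h1, h2, h3, h4])
      map_smul' := fun c φ => eq_of_val_ae_eq hP.isOpen_QT (by
        have h : val (c • S φ) =ᵐ[volume.restrict P.QT] c • val (S φ) := by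
          rw [val_eq, map_smul]
          exact Lp.coeFn_smul _ _
        filter_upwards [h, hS (c • φ), hS φ] with p h1 h2 h3
        simp [h1, h2, h3]) }
  refine ⟨LinearMap.range Sₗ, ?_, ?_⟩
  · ext u
    constructor
    · rintro ⟨φ, rfl⟩
      exact ⟨φ, φ.2, hS φ⟩
    · rintro ⟨φ, hφ, hu⟩
      exact ⟨⟨φ, hφ⟩, eq_of_val_ae_eq hP.isOpen_QT ((hS ⟨φ, hφ⟩).trans hu.symm)⟩
  -- `feSpace` leaves functions arbitrary off the closed cylinder, so finiteness is shown for its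
  -- image in `Y`: vertex values determine the image, which is thus a quotient of a space embedded
  -- in `N → ℝ`.
  · let N : Set (SpaceTime d) := ⋃ K ∈ elements 𝒯, (K : Set (SpaceTime d))
    have hN : Finite N := (h𝒯.finite_elements.biUnion fun K _ => K.finite_toSet).to_subtype
    let R : feSpace P 𝒯 →ₗ[ℝ] (N → ℝ) :=
      (LinearMap.funLeft ℝ ℝ (Subtype.val : N → SpaceTime d)).comp (feSpace P 𝒯).subtype
    have hker : LinearMap.ker R ≤ LinearMap.ker Sₗ := by
      intro φ hφ
      rw [LinearMap.mem_ker] at hφ ⊢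
      have hφ0 : ∀ p ∈ closure P.QT, (φ : SpaceTime d → ℝ) p = 0 := fun p hp => by
        obtain ⟨K, hK, hpK⟩ := h𝒯.exists_element hp
        obtain ⟨A, hA⟩ := (show P.IsFEFun 𝒯 φ from φ.2).affine K hK
        have hKA : (K : Set (SpaceTime d)) ⊆ A ⁻¹' {0} := fun q hq => by
          rw [mem_preimage, ← hA (subset_convexHull ℝ _ hq)]
          exact congrFun hφ ⟨q, mem_biUnion hK hq⟩
        rw [hA hpK]
        exact convexHull_min hKA ((convex_singleton 0).affine_preimage A) hpK
      refine eq_of_val_ae_eq hP.isOpen_QT ?_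
      have h : val (0 : P.Y) =ᵐ[volume.restrict P.QT] 0 := by
        rw [val_eq, map_zero]
        exact Lp.coeFn_zero _ _ _
      filter_upwards [hS φ, h, ae_restrict_mem hP.isOpen_QT.measurableSet] with p h1 h2 hp
      rw [h2, show val (Sₗ φ) p = _ from h1, hφ0 p (subset_closure hp)]
      rfl
    have hq : FiniteDimensional ℝ (feSpace P 𝒯 ⧸ LinearMap.ker R) :=
      Module.Finite.equiv R.quotKerEquivRange.symm
    rw [← Submodule.range_liftQ _ Sₗ hker]
    infer_instance

end InterfaceData

namespace InterfaceData

variable {d : ℕ} {P : InterfaceData d} {𝒯 : Geometry.SimplicialComplex ℝ (SpaceTime d)}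

/-! ### The discrete interface and the discrete diffusion coefficient -/

theorem finrank_spaceTime : Module.finrank ℝ (SpaceTime d) = d + 1 := by
  simp [SpaceTime, Space]

/-- Affinely, `d + 1` points span dimension at most `d`, one less than that of space-time. -/
theorem volume_convexHull_eq_zero {s : Finset (SpaceTime d)} (hs : s.card = d + 1) :
    volume (convexHull ℝ (s : Set (SpaceTime d))) = 0 := by
  classical
  refine measure_mono_null (convexHull_subset_affineSpan _)
    (Measure.addHaar_affineSubspace volume _ fun htop => ?_)
  have h1 := AffineSubspace.vectorSpan_eq_top_of_affineSpan_eq_top ℝ _ _ htop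
  have h2 := finrank_vectorSpan_image_finset_le ℝ (id : SpaceTime d → SpaceTime d) s hs
  rw [Finset.image_id, h1, finrank_top, finrank_spaceTime] at h2
  omega

theorem Γh_eq_biUnion (P : InterfaceData d) (𝒯 : Geometry.SimplicialComplex ℝ (SpaceTime d)) :
    P.Γh 𝒯 = ⋃ s ∈ {s | s ∈ 𝒯.faces ∧ s.card = d + 1 ∧ (s : Set (SpaceTime d)) ⊆ P.Γst},
      convexHull ℝ (s : Set (SpaceTime d)) := by
  ext p
  simp only [Γh, mem_ofPred_eq, mem_iUnion, exists_prop, and_assoc]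

theorem IsFittedMesh.volume_Γh (h𝒯 : P.IsFittedMesh 𝒯) : volume (P.Γh 𝒯) = 0 := by
  rw [Γh_eq_biUnion]
  exact (measure_biUnion_null_iff (h𝒯.finite.subset fun s hs => hs.1).countable).2
    fun s hs => volume_convexHull_eq_zero hs.2.1

theorem IsFittedMesh.measurableSet_Qh (hP : P.IsAdmissible) (h𝒯 : P.IsFittedMesh 𝒯) (i : Fin 2) :
    MeasurableSet (P.Qh 𝒯 i) := by
  have hΓ : MeasurableSet (P.Γh 𝒯) := by
    rw [Γh_eq_biUnion]
    exact (h𝒯.finite.subset fun s hs => hs.1).measurableSet_biUnion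
      fun s _ => (isClosed_convexHull_finset s).measurableSet
  have hU : MeasurableSet (⋃ K ∈ {K | K ∈ elements 𝒯 ∧ P.OnSide i K},
      convexHull ℝ (K : Set (SpaceTime d))) :=
    (h𝒯.finite_elements.subset fun K hK => hK.1).measurableSet_biUnion
      fun K _ => (isClosed_convexHull_finset K).measurableSet
  have : P.Qh 𝒯 i = P.QT ∩ ((P.Γh 𝒯)ᶜ ∩ ⋃ K ∈ {K | K ∈ elements 𝒯 ∧ P.OnSide i K},
      convexHull ℝ (K : Set (SpaceTime d))) := by
    ext p
    simp only [Qh, mem_ofPred_eq, mem_inter_iff, mem_compl_iff, mem_iUnion, exists_prop, and_assoc]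
  rw [this]
  exact hP.isOpen_QT.measurableSet.inter (hΓ.compl.inter hU)

theorem IsFittedMesh.measurable_κh (hP : P.IsAdmissible) (h𝒯 : P.IsFittedMesh 𝒯) :
    Measurable (P.κh 𝒯) := by
  classical
  unfold κh
  exact Measurable.ite (h𝒯.measurableSet_Qh hP 0) measurable_const
    (Measurable.ite (h𝒯.measurableSet_Qh hP 1) measurable_const measurable_const)

theorem norm_κh_le (hP : P.IsAdmissible) (p : SpaceTime d) : ‖P.κh 𝒯 p‖ ≤ P.κ 0 + P.κ 1 := by
  have h0 := hP.κ_pos 0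
  have h1 := hP.κ_pos 1
  unfold κh
  split_ifs
  · rw [Real.norm_of_nonneg h0.le]; linarith
  · rw [Real.norm_of_nonneg h1.le]; linarith
  · rw [norm_zero]; linarith

theorem κh_nonneg (hP : P.IsAdmissible) (p : SpaceTime d) : 0 ≤ P.κh 𝒯 p := by
  have h0 := hP.κ_pos 0
  have h1 := hP.κ_pos 1
  unfold κh
  split_ifs <;> linarith

/-- Interface points are limits of `Q 0` because the space-time interface is the common boundary. -/
theorem IsAdmissible.closure_QT_subset (hP : P.IsAdmissible) :
    closure P.QT ⊆ closure (P.Q 0) ∪ closure (P.Q 1) := by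
  refine closure_minimal (fun p hp => ?_) (isClosed_closure.union isClosed_closure)
  have hp1 := hp.1
  rw [hP.decomposition p.2 (Ioo_subset_Icc_self hp.2)] at hp1
  rcases hp1 with (h | h) | h
  · exact Or.inl (subset_closure ⟨hp.2, h⟩)
  · exact Or.inr (subset_closure ⟨hp.2, h⟩)
  · have hΓ : p ∈ P.Γst := ⟨Ioo_subset_Icc_self hp.2, h⟩
    rw [← hP.interface] at hΓ
    exact Or.inl (frontier_subset_closure hΓ.1)

/-- A cut element has only `d + 1` of its `d + 2` vertices on the interface; the remaining vertex
lies in one of the two closures and decides the side. -/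
theorem IsFittedMesh.exists_onSide (hP : P.IsAdmissible) (h𝒯 : P.IsFittedMesh 𝒯)
    {K : Finset (SpaceTime d)} (hK : K ∈ elements 𝒯) : P.OnSide 0 K ∨ P.OnSide 1 K := by
  rcases h𝒯.fitted K hK with h | h | ⟨hcut, hcard⟩
  · exact Or.inl (Or.inl h)
  · exact Or.inr (Or.inl h)
  · obtain ⟨p, hpK, hpΓ⟩ : ∃ p ∈ K, p ∉ P.Γst := by
      by_contra! hall
      have : {p | p ∈ K ∧ p ∈ P.Γst} = (K : Set (SpaceTime d)) := by
        ext p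
        exact ⟨fun hp => hp.1, fun hp => ⟨hp, hall p hp⟩⟩
      rw [this, ncard_coe_finset, hK.2] at hcard
      omega
    have hpQ : p ∈ closure P.QT := h𝒯.convexHull_subset hK.1 (subset_convexHull ℝ _ hpK)
    rcases hP.closure_QT_subset hpQ with h | h
    · exact Or.inl (Or.inr ⟨hcut, p, hpK, hpΓ, h⟩)
    · exact Or.inr (Or.inr ⟨hcut, p, hpK, hpΓ, h⟩)

/-- Off the null set `Γh` every point of the cylinder lies in an element, and every element has a
side, so the default value `0` does not occur. -/
theorem IsFittedMesh.ae_κh_pos (hP : P.IsAdmissible) (h𝒯 : P.IsFittedMesh 𝒯) :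
    ∀ᵐ p ∂volume.restrict P.QT, 0 < P.κh 𝒯 p := by
  refine (ae_restrict_iff' hP.isOpen_QT.measurableSet).2 ?_
  have hΓ : ∀ᵐ p ∂(volume : Measure (SpaceTime d)), p ∉ P.Γh 𝒯 :=
    measure_eq_zero_iff_ae_notMem.1 h𝒯.volume_Γh
  filter_upwards [hΓ] with p hpΓ hp
  obtain ⟨K, hK, hpK⟩ := h𝒯.exists_element (subset_closure hp)
  unfold κh
  split_ifs with h0 h1
  · exact hP.κ_pos 0
  · exact hP.κ_pos 1
  · rcases h𝒯.exists_onSide hP hK with h | h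
    · exact absurd ⟨hp, hpΓ, K, hK, h, hpK⟩ h0
    · exact absurd ⟨hp, hpΓ, K, hK, h, hpK⟩ h1

/-! ### The velocity -/

/-- The order-zero derivative is the field itself, so the case `m = 0` of the assumption is joint
continuity. -/
theorem IsVelocity.aestronglyMeasurable (hP : P.IsAdmissible) :
    AEStronglyMeasurable (fun p : SpaceTime d => P.vel p.1 p.2) (volume.restrict P.QT) := by
  have hc : ContinuousOn (fun p : SpaceTime d => P.vel p.1 p.2) P.QT := by
    have h0 := hP.velocity.continuousOn 0 (by norm_num)
    have h1 : ContinuousOn (fun p : SpaceTime d =>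
        iteratedFDeriv ℝ 0 (fun x => P.vel x p.2) p.1 0) (P.Ω ×ˢ Icc 0 P.T) :=
      (ContinuousMultilinearMap.apply ℝ (fun _ : Fin 0 => Space d) (Space d)
        0).continuous.comp_continuousOn h0
    simp only [iteratedFDeriv_zero_apply] at h1
    exact h1.mono (prod_mono_right Ioo_subset_Icc_self)
  exact hc.aestronglyMeasurable hP.isOpen_QT.measurableSet

theorem IsVelocity.exists_bound (hP : P.IsAdmissible) :
    ∃ C, ∀ p ∈ P.QT, ‖P.vel p.1 p.2‖ ≤ C := by
  obtain ⟨C, hC⟩ := hP.velocity.bounded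
  exact ⟨C, fun p hp => hC p.1 hp.1 p.2 (Ioo_subset_Icc_self hp.2)⟩

theorem IsVelocity.integral_inner_grad_mul_val (hP : P.IsAdmissible) (w : P.Y) :
    ∫ p in P.QT, ⟪P.vel p.1 p.2, grad w p⟫_ℝ * val w p = 0 := by
  obtain ⟨C, hC⟩ := IsVelocity.exists_bound hP
  have h := MovingInterface.integral_inner_grad_mul_val (a := 0) (b := P.T) hP.isOpen
    (β := fun p => P.vel p.1 p.2) (c := 0) (IsVelocity.aestronglyMeasurable hP) hC
    (fun t ht => (hP.velocity.contDiffOn t (Ioo_subset_Icc_self ht)).of_le (by norm_num))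
    (fun x hx t ht => hP.velocity.div_eq_zero x hx t (Ioo_subset_Icc_self ht)) w
  rw [zero_div, neg_zero, zero_mul] at h
  exact h

/-! ### The bilinear form -/

/-- Writes the right side of `HasTimeDeriv` as a pairing that is visibly linear in `u`. -/
theorem exists_integral_mul_derivT_eq_inner {Q : Set (SpaceTime d)} (ψ : TestFun Q) :
    ∃ z : Lp ℝ 2 (volume.restrict Q), ∀ u : H10 Q,
      ∫ p in Q, val u p * derivT ψ.toFun p = ⟪z, valL u⟫_ℝ := by
  have hm : MemLp (derivT ψ.toFun) 2 (volume.restrict Q) := by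
    have h : derivT ψ.toFun = fun p => fderiv ℝ ψ.toFun p (0, 1) := funext ψ.derivT_eq
    rw [h]
    exact Continuous.memLp_of_hasCompactSupport
      ((ψ.contDiff.continuous_fderiv one_ne_zero).clm_apply continuous_const)
      (ψ.hasCompactSupport.fderiv_apply ℝ _)
  refine ⟨hm.toLp, fun u => ?_⟩
  rw [L2.inner_def]
  refine integral_congr_ae ?_
  filter_upwards [hm.coeFn_toLp] with p hp
  rw [hp, val_eq]
  simp

theorem HasTimeDeriv.add {Q : Set (SpaceTime d)} {u w : H10 Q} {g g' : StrongDual ℝ (H10 Q)}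
    (hu : HasTimeDeriv u g) (hw : HasTimeDeriv w g') : HasTimeDeriv (u + w) (g + g') := by
  intro ψ
  obtain ⟨z, hz⟩ := exists_integral_mul_derivT_eq_inner ψ
  rw [hz, map_add, inner_add_right, ← hz, ← hz, add_apply, hu ψ, hw ψ, neg_add]

theorem HasTimeDeriv.smul {Q : Set (SpaceTime d)} {u : H10 Q} {g : StrongDual ℝ (H10 Q)} (c : ℝ)
    (hu : HasTimeDeriv u g) : HasTimeDeriv (c • u) (c • g) := by
  intro ψ
  obtain ⟨z, hz⟩ := exists_integral_mul_derivT_eq_inner ψ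
  rw [hz, map_smul, real_inner_smul_right, ← hz, smul_apply, hu ψ, smul_eq_mul, mul_neg]

/-- `timeDeriv` is a choice; density of the test functions makes it canonical, and hence linear. -/
theorem timeDeriv_eq (u : P.X₀) {g : StrongDual ℝ P.Y} (hg : HasTimeDeriv (u : P.Y) g) :
    P.timeDeriv u = g :=
  StrongDual.ext_toH10 fun ψ => (P.hasTimeDeriv_timeDeriv u ψ).trans (hg ψ).symm

/-- A first order and a second order form on `H^{1,0}_0(Q)`, given by operators on `L²`. -/
def spatialForm {Q : Set (SpaceTime d)}
    (A : Lp (Space d) 2 (volume.restrict Q) →L[ℝ] Lp ℝ 2 (volume.restrict Q))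
    (D : Lp (Space d) 2 (volume.restrict Q) →L[ℝ] Lp (Space d) 2 (volume.restrict Q)) :
    H10 Q →ₗ[ℝ] H10 Q →ₗ[ℝ] ℝ :=
  ((innerₗ _).flip.comp (A.comp gradL).toLinearMap).compl₂ valL.toLinearMap +
    ((innerₗ _).flip.comp (D.comp gradL).toLinearMap).compl₂ gradL.toLinearMap

theorem spatialForm_apply {Q : Set (SpaceTime d)}
    (A : Lp (Space d) 2 (volume.restrict Q) →L[ℝ] Lp ℝ 2 (volume.restrict Q))
    (D : Lp (Space d) 2 (volume.restrict Q) →L[ℝ] Lp (Space d) 2 (volume.restrict Q))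
    (u φ : H10 Q) :
    spatialForm A D u φ = ⟪valL φ, A (gradL u)⟫_ℝ + ⟪gradL φ, D (gradL u)⟫_ℝ := rfl

set_option maxHeartbeats 800000 in
/-- The spatial part of the bilinear form through bounded operators on `L²`. -/
theorem exists_ah_eq (hP : P.IsAdmissible) (h𝒯 : P.IsFittedMesh 𝒯) :
    ∃ B : P.Y →ₗ[ℝ] P.Y →ₗ[ℝ] ℝ, (∀ (u : P.X₀) φ, P.ah 𝒯 u φ = P.timeDeriv u φ + B u φ) ∧
      (∀ u, 0 ≤ B u u) ∧ ∀ u, B u u = 0 → gradL u = 0 := by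
  obtain ⟨C, hC⟩ := IsVelocity.exists_bound hP
  obtain ⟨A, hA⟩ := exists_convection_clm (IsVelocity.aestronglyMeasurable hP)
    ((ae_restrict_iff' hP.isOpen_QT.measurableSet).2 (Filter.Eventually.of_forall hC))
  obtain ⟨D, hD⟩ := exists_diffusion_clm (Q := P.QT) (k := P.κh 𝒯)
    (h𝒯.measurable_κh hP).aestronglyMeasurable (Filter.Eventually.of_forall (norm_κh_le hP))
  have hBd : ∀ u, spatialForm A D u u =
      ∫ p in P.QT, P.κh 𝒯 p * ⟪grad u p, grad u p⟫_ℝ := fun u => by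
    have h1 : ⟪valL u, A (gradL u)⟫_ℝ = 0 :=
      (hA u u).2.symm.trans (IsVelocity.integral_inner_grad_mul_val hP u)
    rw [(hD u u).2, spatialForm_apply, h1, zero_add]
  have hnn : ∀ u : P.Y, ∀ p, 0 ≤ P.κh 𝒯 p * ⟪grad u p, grad u p⟫_ℝ := fun u p =>
    mul_nonneg (κh_nonneg hP p) real_inner_self_nonneg
  refine ⟨spatialForm A D, fun u φ => ?_, fun u => ?_, fun u hu => ?_⟩
  · unfold ah
    rw [integral_add (hA u φ).1 (hD u φ).1, (hA u φ).2, (hD u φ).2, spatialForm_apply]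
  · rw [hBd]
    exact integral_nonneg (hnn u)
  · rw [hBd, integral_eq_zero_iff_of_nonneg (hnn u) (hD u u).1] at hu
    rw [Lp.eq_zero_iff_ae_eq_zero]
    filter_upwards [hu, h𝒯.ae_κh_pos hP] with p hp hκ
    exact inner_self_eq_zero.1 ((mul_eq_zero.1 hp).resolve_left hκ.ne')

/-! ### Solvability of the discrete problem. -/

/-- A linear map from a finite-dimensional space to its dual is bijective if the quadratic form
vanishes only at zero. -/
theorem existsUnique_of_definite {V : Type*} [AddCommGroup V] [Module ℝ V] [FiniteDimensional ℝ V]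
    (B : V →ₗ[ℝ] Module.Dual ℝ V) (hB : ∀ u, B u u = 0 → u = 0) (f : Module.Dual ℝ V) :
    ∃! u, B u = f := by
  have hinj : Function.Injective B := (injective_iff_map_eq_zero B).2 fun u hu => hB u (by simp [hu])
  have hsurj := (LinearMap.injective_iff_surjective_of_finrank_eq_finrank
    (Subspace.dual_finrank_eq (K := ℝ) (V := V)).symm).1 hinj
  obtain ⟨u, hu⟩ := hsurj f
  exact ⟨u, hu, fun w hw => hinj (hw.trans hu.symm)⟩

theorem Vh_subset_X₀ (hP : P.IsAdmissible) (h𝒯 : P.IsFittedMesh 𝒯) : P.Vh 𝒯 ⊆ P.X₀ := by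
  rintro u ⟨φ, hφ, hu⟩
  obtain ⟨w, hw, hwφ⟩ := hφ.exists_mem_X₀ hP h𝒯
  rwa [eq_of_val_ae_eq hP.isOpen_QT (hu.trans hwφ.symm)]

theorem existsUnique_discrete_solution (hd : d ≠ 0) (hP : P.IsAdmissible)
    (h𝒯 : P.IsFittedMesh 𝒯) (f : StrongDual ℝ P.Y) :
    ∃! u : P.X₀, (u : P.Y) ∈ P.Vh 𝒯 ∧ ∀ φ ∈ P.Vh 𝒯, P.ah 𝒯 u φ = f φ := by
  obtain ⟨V, hV, hfin⟩ := exists_submodule_eq_Vh hP h𝒯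
  obtain ⟨B, hB, hB0, hBz⟩ := exists_ah_eq hP h𝒯
  have hmem : ∀ u : P.Y, u ∈ V ↔ u ∈ P.Vh 𝒯 := fun u => by rw [← hV]; rfl
  let ι : V → P.X₀ := fun u => ⟨u, Vh_subset_X₀ hP h𝒯 ((hmem u).1 u.2)⟩
  have hadd : ∀ u w, P.timeDeriv (ι (u + w)) = P.timeDeriv (ι u) + P.timeDeriv (ι w) := fun u w =>
    timeDeriv_eq _ (HasTimeDeriv.add (P.hasTimeDeriv_timeDeriv (ι u))
      (P.hasTimeDeriv_timeDeriv (ι w)))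
  have hsmul : ∀ (c : ℝ) u, P.timeDeriv (ι (c • u)) = c • P.timeDeriv (ι u) := fun c u =>
    timeDeriv_eq _ (HasTimeDeriv.smul c (P.hasTimeDeriv_timeDeriv (ι u)))
  let F : V →ₗ[ℝ] Module.Dual ℝ V := LinearMap.mk₂ ℝ
    (fun u φ => P.timeDeriv (ι u) φ + B u φ)
    (fun u w φ => by rw [hadd]; simp; ring)
    (fun c u φ => by rw [hsmul]; simp; ring)
    (fun u φ ζ => by simp; ring)
    (fun c u φ => by simp; ring)
  have hF : ∀ u φ : V, F u φ = P.ah 𝒯 (ι u) φ := fun u φ => (hB (ι u) φ).symm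
  have hdef : ∀ u, F u u = 0 → u = 0 := fun u hu => by
    obtain ⟨φ, hφ, huφ⟩ := (hmem u).1 u.2
    have h1 := hφ.hasTimeDeriv_self_nonneg hP h𝒯 huφ (P.hasTimeDeriv_timeDeriv (ι u))
    -- Two nonnegative terms with sum zero both vanish, so the gradient is zero.
    have h2 : P.timeDeriv (ι u) u + B u u = 0 := hu
    have h3 := hB0 u
    have h4 : gradL (u : P.Y) = 0 := hBz u (by linarith)
    exact Subtype.ext (eq_zero_of_grad_eq_zero hd hP.isOpen hP.isBounded h4)
  obtain ⟨u, hu, huniq⟩ := existsUnique_of_definite F hdef (f.toLinearMap.comp V.subtype)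
  refine ⟨ι u, ⟨(hmem u).1 u.2, fun φ hφ => ?_⟩, fun w hw => ?_⟩
  · rw [← hF u ⟨φ, (hmem φ).2 hφ⟩, hu]
    rfl
  · have h := huniq ⟨w, (hmem w).2 hw.1⟩ (LinearMap.ext fun φ => by
      rw [hF]
      exact hw.2 φ ((hmem φ).1 φ.2))
    rw [← h]

end InterfaceData

end MovingInterface

end

/-- The first clause ensures that `Vh`, defined as a subset of `Y`, represents every finite element
function, so the inclusion in `X₀` loses none of them. -/
theorem mainTheorem2 (d : ℕ) (hd : d = 1 ∨ d = 2)
    (P : MovingInterface.InterfaceData d) (hP : P.IsAdmissible)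
    (𝒯 : Geometry.SimplicialComplex ℝ (MovingInterface.SpaceTime d)) (h𝒯 : P.IsFittedMesh 𝒯) :
    (∀ φ, P.IsFEFun 𝒯 φ → ∃ u ∈ P.X₀, MovingInterface.val u =ᵐ[volume.restrict P.QT] φ) ∧
    P.Vh 𝒯 ⊆ P.X₀ ∧
    ∀ f : StrongDual ℝ P.Y, ∃! u : P.X₀, (u : P.Y) ∈ P.Vh 𝒯 ∧
      ∀ φ ∈ P.Vh 𝒯, P.ah 𝒯 u φ = f φ :=
  ⟨fun _ hφ => hφ.exists_mem_X₀ hP h𝒯, MovingInterface.InterfaceData.Vh_subset_X₀ hP h𝒯,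
    MovingInterface.InterfaceData.existsUnique_discrete_solution (by omega) hP h𝒯⟩
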